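/- Let $H$ be a (real or complex) Hilbert space and let $A$ be a nonnegative self-adjoint linear operator on $H$ that is an unbounded positive multiplication operator: there are a sequence $\{e_n\}\subseteq H$ of orthonormal vectors (not necessarily a Hilbert basis) and an unbounded sequence $\{\lambda_n\}$ of positive real numbers such that $Ae_n=\lambda_n e_n$ for all $n$. Let $T_0>0$ and $\mu_2>\mu_1>0$ be real numbers, and let $\omega:(0,T_0]\to(0,+\infty)$ be a nonincreasing function such that $\omega(t)\to+\infty$ as $t\to 0^+$. Let $\mathcal{PS}^{(1)}$ be the set of functions $c\in C^0([0,T_0])\cap C^1((0,T_0])$ such that $\mu_1\le c(t)\le\mu_2$ for all $t\in(0,T_0)$ and $|c'(t)|\le \omega(t)/t$ for all $t\in(0,T_0]$, with the distance $$d(c_1,c_2)=\sup_{t\in(0,T_0)}|c_1(t)-c_2(t)|+\sup_{t\in(0,T_0)}\frac{t^2}{\omega(t)}\,|c_1'(t)-c_2'(t)|.$$ Hyperdistributions are the linear functionals on the union over $r\ge 0$ of the spectral subspaces of $A$ for $[0,r]$ that are continuous on each of these subspaces; $H$ is contained in their space through the inner product. For real $\alpha\ge 0$ let $D(A^\alpha)\subseteq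 H$ be the domain of $A^\alpha$, and for $\alpha<0$ let $D(A^\alpha)$ be the dual of $D(A^{-\alpha})$ (with its graph norm), regarded as a space of hyperdistributions. For $c\in\mathcal{PS}^{(1)}$, the equation $u''(t)+c(t)Au(t)=0$ in $[0,T_0]$ is said to exhibit an infinite derivative loss if it has a hyperdistribution-valued solution $u$ (meaning that the equation holds for the pairing with every vector of the above union of spectral subspaces) such that $$(u(0),u'(0))\in D(A^{\beta+1/2})\times D(A^{\beta})\qquad\text{for every }\beta>0,$$ but $$(u(t),u'(t))\notin D(A^{-\beta+1/2})\times D(A^{-\beta})\qquad\text{for every }\beta>0\text{ and every }t\in(0,T_0].$$ Then $\mathcal{PS}^{(1)}$ is a complete metric space, and the set of all $c\in\mathcal{PS}^{(1)}$ for which $u''(t)+c(t)Au(t)=0$ exhibits an infinite derivative loss is residual in $\mathcal{PS}^{(1)}$ (its complement is contained in a countable union of nowhere dense sets). -/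

import Mathlib

open Set Filter Topology MeasureTheory
open scoped NNReal ENNReal InnerProductSpace

noncomputable section

namespace DerivativeLoss

section Operator

variable {𝕜 : Type*} [RCLike 𝕜] {H : Type*} [NormedAddCommGroup H] [InnerProductSpace 𝕜 H]

/-- `A` is a nonnegative self-adjoint (densely defined, possibly unbounded) operator on `H`. -/
def IsNonnegSelfAdjoint [CompleteSpace H] (A : H →ₗ.[𝕜] H) : Prop :=
  IsSelfAdjoint A ∧ ∀ x : A.domain, 0 ≤ RCLike.re ⟪A x, (x : H)⟫_𝕜

/-- `A` is an unbounded positive multiplication operator: there are an orthonormal sequence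
`e n` (not necessarily a Hilbert basis) and an unbounded sequence of positive real numbers
`ev n` such that `A (e n) = ev n • e n`. -/
def IsUnboundedPosMulOperator (A : H →ₗ.[𝕜] H) : Prop :=
  ∃ (e : ℕ → H) (ev : ℕ → ℝ), Orthonormal 𝕜 e ∧ (∀ n, 0 < ev n) ∧ ¬ BddAbove (range ev) ∧
    ∀ n, ∃ h : e n ∈ A.domain, A ⟨e n, h⟩ = (ev n : 𝕜) • e n

/-! ### Fractional powers -/

/-- `μ` is the spectral measure of the vector `x` with respect to `A`, that is
`μ(B) = ‖E(B) x‖²` where `E` is the spectral resolution of `A`. It is characterized by its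
Stieltjes transform: `⟪x, (A + s)⁻¹ x⟫ = ∫ (ξ + s)⁻¹ dμ(ξ)` for every `s > 0`. (If `A` is
self-adjoint and nonnegative, then the equation `A y + s y = x` has a unique solution `y`, and
there is exactly one such `μ` on `[0, ∞)`.) -/
def IsSpectralMeasure (A : H →ₗ.[𝕜] H) (x : H) (μ : Measure ℝ≥0) : Prop :=
  IsFiniteMeasure μ ∧ ∀ s : ℝ, 0 < s → ∀ y : A.domain, A y + (s : 𝕜) • (y : H) = x →
    ⟪x, (y : H)⟫_𝕜 = ((∫ ξ : ℝ≥0, ((ξ : ℝ) + s)⁻¹ ∂μ : ℝ) : 𝕜)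

/-- The norm `‖A ^ α x‖ = (∫ ξ ^ (2 α) dμ(ξ)) ^ (1 / 2)`, where `μ` is the spectral measure of
`x`, as an element of `[0, ∞]`, for `α ≥ 0`. It is finite if and only if `x ∈ D(A ^ α)`. (The
infimum ranges over one measure.) -/
def powNorm (A : H →ₗ.[𝕜] H) (α : ℝ) (x : H) : ℝ≥0∞ :=
  ⨅ (μ : Measure ℝ≥0) (_ : IsSpectralMeasure A x μ),
    (∫⁻ ξ : ℝ≥0, (ξ : ℝ≥0∞) ^ (2 * α) ∂μ) ^ (1 / 2 : ℝ)

/-! ### Hyperdistributions -/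

/-- The vectors `φ ∈ ⋂ₙ D(A ^ n)` such that `‖A ^ n φ‖ ≤ C r ^ n` for all `n` and some `C`. For a
nonnegative self-adjoint `A` this is the spectral subspace of `A` for the interval `[0, r]`. In
the definition, `ψ n` stands for `A ^ n φ`. -/
def band (A : H →ₗ.[𝕜] H) (r : ℝ≥0) : Submodule 𝕜 H where
  carrier := {φ | ∃ (C : ℝ) (ψ : ℕ → H), ψ 0 = φ ∧ (∀ n, (ψ n, ψ (n + 1)) ∈ A.graph) ∧
    ∀ n, ‖ψ n‖ ≤ C * (r : ℝ) ^ n}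
  zero_mem' := ⟨0, 0, rfl, fun _ => A.graph.zero_mem, fun n => by simp⟩
  add_mem' := by
    rintro a b ⟨C, ψ, h0, hg, hb⟩ ⟨C', ψ', h0', hg', hb'⟩
    refine ⟨C + C', ψ + ψ', by simp [h0, h0'], fun n => A.graph.add_mem (hg n) (hg' n),
      fun n => ?_⟩
    calc ‖ψ n + ψ' n‖ ≤ ‖ψ n‖ + ‖ψ' n‖ := norm_add_le _ _
      _ ≤ C * (r : ℝ) ^ n + C' * (r : ℝ) ^ n := add_le_add (hb n) (hb' n)
      _ = (C + C') * (r : ℝ) ^ n := by ring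
  smul_mem' := by
    rintro k a ⟨C, ψ, h0, hg, hb⟩
    refine ⟨‖k‖ * C, k • ψ, by simp [h0], fun n => A.graph.smul_mem k (hg n), fun n => ?_⟩
    calc ‖k • ψ n‖ = ‖k‖ * ‖ψ n‖ := norm_smul _ _
      _ ≤ ‖k‖ * (C * (r : ℝ) ^ n) := mul_le_mul_of_nonneg_left (hb n) (norm_nonneg _)
      _ = ‖k‖ * C * (r : ℝ) ^ n := by ring

theorem band_mono (A : H →ₗ.[𝕜] H) {r s : ℝ≥0} (h : r ≤ s) : band A r ≤ band A s := by
  rintro φ ⟨C, ψ, h0, hg, hb⟩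
  have hC : 0 ≤ C := by
    have := (norm_nonneg _).trans (hb 0)
    simpa using this
  exact ⟨C, ψ, h0, hg, fun n => (hb n).trans
    (mul_le_mul_of_nonneg_left (pow_le_pow_left₀ r.2 h n) hC)⟩

/-- The space of test vectors: the union of the spectral subspaces of `A` for `[0, r]`, `r ≥ 0`. -/
def testSpace (A : H →ₗ.[𝕜] H) : Submodule 𝕜 H where
  carrier := {φ | ∃ r : ℝ≥0, φ ∈ band A r}
  zero_mem' := ⟨0, (band A 0).zero_mem⟩
  add_mem' := by
    rintro a b ⟨r, hr⟩ ⟨s, hs⟩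
    exact ⟨max r s, (band A _).add_mem (band_mono A (le_max_left _ _) hr)
      (band_mono A (le_max_right _ _) hs)⟩
  smul_mem' := by
    rintro k a ⟨r, hr⟩
    exact ⟨r, (band A r).smul_mem k hr⟩

theorem testSpace_le_domain (A : H →ₗ.[𝕜] H) : testSpace A ≤ A.domain := by
  rintro φ ⟨r, C, ψ, rfl, hg, -⟩
  exact LinearPMap.mem_domain_of_mem_graph (hg 0)

theorem apply_mem_testSpace (A : H →ₗ.[𝕜] H) (φ : testSpace A) :
    A ⟨φ, testSpace_le_domain A φ.2⟩ ∈ testSpace A := by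
  obtain ⟨φ, r, C, ψ, rfl, hg, hb⟩ := φ
  have h1 : A ⟨ψ 0, LinearPMap.mem_domain_of_mem_graph (hg 0)⟩ = ψ 1 :=
    ((LinearPMap.image_iff (LinearPMap.mem_domain_of_mem_graph (hg 0))).2 (hg 0)).symm
  refine ⟨r, C * r, fun n => ψ (n + 1), h1.symm, fun n => hg (n + 1), fun n => ?_⟩
  calc ‖ψ (n + 1)‖ ≤ C * (r : ℝ) ^ (n + 1) := hb (n + 1)
    _ = C * r * (r : ℝ) ^ n := by ring

/-- The operator `A`, as a linear map of the space of test vectors into itself. -/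
def testOp (A : H →ₗ.[𝕜] H) : testSpace A →ₗ[𝕜] testSpace A where
  toFun φ := ⟨A ⟨φ, testSpace_le_domain A φ.2⟩, apply_mem_testSpace A φ⟩
  map_add' φ φ' := Subtype.ext (A.map_add ⟨φ, testSpace_le_domain A φ.2⟩
    ⟨φ', testSpace_le_domain A φ'.2⟩)
  map_smul' k φ := Subtype.ext (A.map_smul k ⟨φ, testSpace_le_domain A φ.2⟩)

/-- A hyperdistribution (a vector that has components with respect to `A`, without any bound on
their growth): a linear functional on the test vectors whose restriction to each spectral subspace
`[0, r]` is continuous. A vector `x : H` is identified with the functional `φ ↦ ⟪x, φ⟫`. -/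
structure Hyperdistribution (A : H →ₗ.[𝕜] H) where
  toLinearMap : testSpace A →ₗ[𝕜] 𝕜
  bound : ∀ r : ℝ≥0, ∃ C : ℝ, ∀ φ : testSpace A, (φ : H) ∈ band A r →
    ‖toLinearMap φ‖ ≤ C * ‖(φ : H)‖

instance (A : H →ₗ.[𝕜] H) : CoeFun (Hyperdistribution A) (fun _ => testSpace A → 𝕜) :=
  ⟨fun T => T.toLinearMap⟩

/-- The space `D(A ^ α)`, for a real exponent `α`, as a subset of the hyperdistributions. For
`α ≥ 0` it is the domain of `A ^ α` in `H`. For `α < 0` it is the dual of `D(A ^ (-α))`, where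
`D(A ^ (-α))` has the graph norm, that is the completion of `H` with respect to the norm of
`(1 + A) ^ α x`. -/
def domPow (A : H →ₗ.[𝕜] H) (α : ℝ) : Set (Hyperdistribution A) :=
  {T | if 0 ≤ α then
      ∃ x : H, (∀ φ : testSpace A, T φ = ⟪x, (φ : H)⟫_𝕜) ∧ powNorm A α x < ∞
    else
      ∃ C : ℝ≥0, ∀ φ : testSpace A, ‖T φ‖ₑ ≤ C * (‖(φ : H)‖ₑ + powNorm A (-α) (φ : H))}

/-! ### The equation -/

/-- `u` is a solution of `u''(t) + c(t) A u(t) = 0` in `[0, T₀]` with values in hyperdistributions,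
and `v` is its time derivative. (For continuous `c` the components `t ↦ u(t) φ` are of class
`C²`; the derivatives at `0` and `T₀` are one-sided.) -/
def IsSolution (A : H →ₗ.[𝕜] H) (T₀ : ℝ) (c : ℝ → ℝ) (u v : ℝ → Hyperdistribution A) : Prop :=
  ∀ φ : testSpace A, ∀ t ∈ Icc 0 T₀,
    HasDerivWithinAt (fun s : ℝ => u s φ) (v t φ) (Icc 0 T₀) t ∧
    HasDerivWithinAt (fun s : ℝ => v s φ) (-((c t : 𝕜) * u t (testOp A φ))) (Icc 0 T₀) t

/-- The problem exhibits an infinite derivative loss: there is a solution whose initial data are in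
`D(A ^ (β + 1/2)) × D(A ^ β)` for all `β > 0`, and for which `(u(t), u'(t))` is not in
`D(A ^ (-β + 1/2)) × D(A ^ (-β))` for all `β > 0` and all `t ∈ (0, T₀]`. -/
def HasInfiniteDerivativeLoss (A : H →ₗ.[𝕜] H) (T₀ : ℝ) (c : ℝ → ℝ) : Prop :=
  ∃ u v : ℝ → Hyperdistribution A, IsSolution A T₀ c u v ∧
    (∀ β : ℝ, 0 < β → u 0 ∈ domPow A (β + 1 / 2) ∧ v 0 ∈ domPow A β) ∧
    ∀ β : ℝ, 0 < β → ∀ t ∈ Ioc 0 T₀, ¬ (u t ∈ domPow A (-β + 1 / 2) ∧ v t ∈ domPow A (-β))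

end Operator

/-! ### The space of propagation speeds -/

/-- The set of `c ∈ C⁰([0, T₀]) ∩ C¹((0, T₀])` with `μ₁ ≤ c ≤ μ₂` in `(0, T₀)` and
`|c'(t)| ≤ ω(t) / t` in `(0, T₀]`. Functions on `[0, T₀]` are represented by their extension by
zero to the real line; the derivative at `T₀` is one-sided. -/
@[ext]
structure PS1 {T₀ : ℝ} (hT : 0 < T₀) (μ₁ μ₂ : ℝ) (ω : ℝ → ℝ) where
  toFun : ℝ → ℝ
  zero_outside : ∀ t, t ∉ Icc 0 T₀ → toFun t = 0
  continuousOn : ContinuousOn toFun (Icc 0 T₀)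
  contDiffOn : ContDiffOn ℝ 1 toFun (Ioc 0 T₀)
  hyperbolic : ∀ t ∈ Ioo 0 T₀, μ₁ ≤ toFun t ∧ toFun t ≤ μ₂
  deriv_le : ∀ t ∈ Ioc 0 T₀, |derivWithin toFun (Ioc 0 T₀) t| ≤ ω t / t

namespace PS1

variable {T₀ : ℝ} {hT : 0 < T₀} {μ₁ μ₂ : ℝ} {ω : ℝ → ℝ}

/-- The derivative of a propagation speed in `(0, T₀]`. -/
def deriv' (c : PS1 hT μ₁ μ₂ ω) (t : ℝ) : ℝ := derivWithin c.toFun (Ioc 0 T₀) t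

/-- The distance
`sup |c₁ - c₂| + sup (t² / ω(t)) |c₁' - c₂'|`, where both suprema are over `(0, T₀)`. -/
instance : Dist (PS1 hT μ₁ μ₂ ω) where
  dist c₁ c₂ := (⨆ t : Ioo (0 : ℝ) T₀, |c₁.toFun t - c₂.toFun t|) +
    ⨆ t : Ioo (0 : ℝ) T₀, (t : ℝ) ^ 2 / ω t * |c₁.deriv' t - c₂.deriv' t|

theorem dist_def (c₁ c₂ : PS1 hT μ₁ μ₂ ω) :
    dist c₁ c₂ = (⨆ t : Ioo (0 : ℝ) T₀, |c₁.toFun t - c₂.toFun t|) +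
      ⨆ t : Ioo (0 : ℝ) T₀, (t : ℝ) ^ 2 / ω t * |c₁.deriv' t - c₂.deriv' t| := rfl

theorem omega_nonneg (c : PS1 hT μ₁ μ₂ ω) (t : Ioo (0 : ℝ) T₀) : 0 ≤ ω t := by
  have h := (abs_nonneg _).trans (c.deriv_le t ⟨t.2.1, t.2.2.le⟩)
  by_contra hneg
  exact absurd h (not_le.2 (div_neg_of_neg_of_pos (not_le.1 hneg) t.2.1))

theorem bddAbove_fun (c₁ c₂ : PS1 hT μ₁ μ₂ ω) :
    BddAbove (range fun t : Ioo (0 : ℝ) T₀ => |c₁.toFun t - c₂.toFun t|) := by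
  refine ⟨μ₂ - μ₁, ?_⟩
  rintro _ ⟨t, rfl⟩
  have h₁ := c₁.hyperbolic t t.2
  have h₂ := c₂.hyperbolic t t.2
  exact abs_le.2 ⟨by linarith, by linarith⟩

theorem bddAbove_deriv (c₁ c₂ : PS1 hT μ₁ μ₂ ω) :
    BddAbove (range fun t : Ioo (0 : ℝ) T₀ =>
      (t : ℝ) ^ 2 / ω t * |c₁.deriv' t - c₂.deriv' t|) := by
  refine ⟨2 * T₀, ?_⟩
  rintro _ ⟨t, rfl⟩
  have ht : (0 : ℝ) < t := t.2.1
  have hω := c₁.omega_nonneg t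
  have h₁ := c₁.deriv_le t ⟨t.2.1, t.2.2.le⟩
  have h₂ := c₂.deriv_le t ⟨t.2.1, t.2.2.le⟩
  have h : |c₁.deriv' t - c₂.deriv' t| ≤ 2 * (ω t / t) := by
    calc |c₁.deriv' t - c₂.deriv' t| ≤ |c₁.deriv' t| + |c₂.deriv' t| := abs_sub _ _
      _ ≤ 2 * (ω t / t) := by unfold deriv'; linarith
  rcases hω.eq_or_lt with h0 | h0
  · simp only [← h0, div_zero, zero_mul]
    linarith
  · calc (t : ℝ) ^ 2 / ω t * |c₁.deriv' t - c₂.deriv' t|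
        ≤ (t : ℝ) ^ 2 / ω t * (2 * (ω t / t)) :=
          mul_le_mul_of_nonneg_left h (by positivity)
      _ = 2 * t := by field_simp
      _ ≤ 2 * T₀ := by linarith [t.2.2]

instance : MetricSpace (PS1 hT μ₁ μ₂ ω) where
  dist_self c := by simp [dist_def]
  dist_comm c₁ c₂ := by simp only [dist_def, abs_sub_comm]
  dist_triangle c₁ c₂ c₃ := by
    have : Nonempty (Ioo (0 : ℝ) T₀) := ⟨⟨T₀ / 2, by constructor <;> linarith⟩⟩
    have h₁ : (⨆ t : Ioo (0 : ℝ) T₀, |c₁.toFun t - c₃.toFun t|) ≤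
        (⨆ t : Ioo (0 : ℝ) T₀, |c₁.toFun t - c₂.toFun t|) +
          ⨆ t : Ioo (0 : ℝ) T₀, |c₂.toFun t - c₃.toFun t| :=
      ciSup_le fun t => (abs_sub_le _ (c₂.toFun t) _).trans
        (add_le_add (le_ciSup (bddAbove_fun c₁ c₂) t) (le_ciSup (bddAbove_fun c₂ c₃) t))
    have h₂ : (⨆ t : Ioo (0 : ℝ) T₀, (t : ℝ) ^ 2 / ω t * |c₁.deriv' t - c₃.deriv' t|) ≤
        (⨆ t : Ioo (0 : ℝ) T₀, (t : ℝ) ^ 2 / ω t * |c₁.deriv' t - c₂.deriv' t|) +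
          ⨆ t : Ioo (0 : ℝ) T₀, (t : ℝ) ^ 2 / ω t * |c₂.deriv' t - c₃.deriv' t| := by
      refine ciSup_le fun t => ?_
      have hω := c₁.omega_nonneg t
      calc (t : ℝ) ^ 2 / ω t * |c₁.deriv' t - c₃.deriv' t|
          ≤ (t : ℝ) ^ 2 / ω t * (|c₁.deriv' t - c₂.deriv' t| + |c₂.deriv' t - c₃.deriv' t|) :=
            mul_le_mul_of_nonneg_left (abs_sub_le _ _ _) (by positivity)
        _ = (t : ℝ) ^ 2 / ω t * |c₁.deriv' t - c₂.deriv' t| +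
            (t : ℝ) ^ 2 / ω t * |c₂.deriv' t - c₃.deriv' t| := mul_add _ _ _
        _ ≤ _ := add_le_add (le_ciSup (bddAbove_deriv c₁ c₂) t)
            (le_ciSup (bddAbove_deriv c₂ c₃) t)
    simp only [dist_def]
    linarith
  eq_of_dist_eq_zero := by
    intro c₁ c₂ h
    have hd : 0 ≤ ⨆ t : Ioo (0 : ℝ) T₀, (t : ℝ) ^ 2 / ω t * |c₁.deriv' t - c₂.deriv' t| :=
      Real.iSup_nonneg fun t => mul_nonneg (div_nonneg (sq_nonneg _) (c₁.omega_nonneg t))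
        (abs_nonneg _)
    have hf : (⨆ t : Ioo (0 : ℝ) T₀, |c₁.toFun t - c₂.toFun t|) ≤ 0 := by
      rw [dist_def] at h
      linarith
    have heq : EqOn c₁.toFun c₂.toFun (Ioo 0 T₀) := fun t ht => by
      have := (le_ciSup (bddAbove_fun c₁ c₂) ⟨t, ht⟩).trans hf
      exact sub_eq_zero.1 (abs_nonpos_iff.1 this)
    have hcl : EqOn c₁.toFun c₂.toFun (Icc 0 T₀) :=
      heq.of_subset_closure c₁.continuousOn c₂.continuousOn Ioo_subset_Icc_self
        (closure_Ioo hT.ne).ge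
    ext t
    by_cases ht : t ∈ Icc 0 T₀
    · exact hcl ht
    · rw [c₁.zero_outside t ht, c₂.zero_outside t ht]

end PS1

end DerivativeLoss

end

/-! The argument is a Baire category argument built on resonance. Along an eigenvector with
eigenvalue `l` the equation becomes w'' + c l w = 0. For each `K`, consider the speeds for which
some mode with `l > K + 2` and data (0, 1) satisfies w² + w'² > l^(4K) on all of [T₀/(K+1), T₀].
These sets (`PS1.amplifying`) are open, since a fixed mode depends continuously on c in the sup
norm. Once they are known to be dense, their intersection is residual.

Density rests on two perturbations. First, the weight t²/ω(t) turns the admissible slope ω(t)/t into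
t, so c can be altered freely near t = 0 at small cost. Hence speeds equal to a constant γ near 0,
with μ₁ < γ < μ₂, are dense (`PS1.exists_dist_lt_const_near_zero`). Second, in the variable x = νt
with ν² = γl, the constant equation is the harmonic oscillator, and `exists_resonance` perturbs it
so that W = sin x · exp P solves the new equation, with P' = Γ sin⁴x / x. The perturbation and its
derivative are O(Γ/x). The resulting slope in t is O(Γ/t) uniformly in ν, which is admissible near 0
for every Γ because ω → ∞. Between mπ, with m fixed, and nπ, with n of order ν, the solution grows
by (n/m)^(Γ/4), that is, by an arbitrary power of l. After the resonance, |c'|/c is bounded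
independently of l, and the energy loses only a constant factor (`PS1.energy_lower_bound`).

For c in the intersection, choose amplified modes with distinct eigenvectors and superpose them with
initial velocities l^(-κ), κ → ∞. These data decay faster than every power of l. At each t > 0 the
components have squared size above l^(2κ) along a tail of the sequence, whereas elements of any
D(A^α) have polynomially bounded components (`hasInfiniteDerivativeLoss_of_amplified`). -/

namespace DerivativeLoss

/-! ### The equation of a single mode -/

/-- `w` is the solution of `w'' + k w = 0` in `[0, T]` with `w(0) = 0` and `w'(0) = 1`, and `w₁` is
its derivative. -/
structure IsModeSolution (T : ℝ) (k w w₁ : ℝ → ℝ) : Prop where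
  deriv_fst : ∀ t ∈ Icc 0 T, HasDerivWithinAt w (w₁ t) (Icc 0 T) t
  deriv_snd : ∀ t ∈ Icc 0 T, HasDerivWithinAt w₁ (-(k t * w t)) (Icc 0 T) t
  init_fst : w 0 = 0
  init_snd : w₁ 0 = 1

theorem hasDerivWithinAt_Ici_of_Icc {E : Type*} [NormedAddCommGroup E] [NormedSpace ℝ E]
    {f : ℝ → E} {f' : E} {a b t : ℝ} (h : HasDerivWithinAt f f' (Icc a b) t) (ht : t ∈ Ico a b) :
    HasDerivWithinAt f f' (Ici t) t :=
  h.mono_of_mem_nhdsWithin (mem_of_superset (Icc_mem_nhdsGE ht.2) (Icc_subset_Icc_left ht.1))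

namespace IsModeSolution

variable {T : ℝ} {k w w₁ : ℝ → ℝ}

theorem mono (h : IsModeSolution T k w w₁) {S : ℝ} (hS : S ≤ T) : IsModeSolution S k w w₁ :=
  ⟨fun t ht => (h.deriv_fst t ⟨ht.1, ht.2.trans hS⟩).mono (Icc_subset_Icc_right hS),
    fun t ht => (h.deriv_snd t ⟨ht.1, ht.2.trans hS⟩).mono (Icc_subset_Icc_right hS),
    h.init_fst, h.init_snd⟩

theorem continuousOn_fst (h : IsModeSolution T k w w₁) : ContinuousOn w (Icc 0 T) :=
  fun t ht => (h.deriv_fst t ht).continuousWithinAt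

theorem continuousOn_snd (h : IsModeSolution T k w w₁) : ContinuousOn w₁ (Icc 0 T) :=
  fun t ht => (h.deriv_snd t ht).continuousWithinAt

/-- Continuous dependence on the coefficient. -/
theorem dist_le (h : IsModeSolution T k w w₁) {k' z z₁ : ℝ → ℝ}
    (h' : IsModeSolution T k' z z₁) {M d B : ℝ} (hM : 1 ≤ M) (hd : 0 ≤ d)
    (hk' : ∀ t ∈ Icc 0 T, |k' t| ≤ M) (hkk : ∀ t ∈ Icc 0 T, |k' t - k t| ≤ d)
    (hB : ∀ t ∈ Icc 0 T, |w t| ≤ B) :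
    ∀ t ∈ Icc 0 T, |z t - w t| ≤ d * (B / M * (Real.exp (M * T) - 1)) ∧
      |z₁ t - w₁ t| ≤ d * (B / M * (Real.exp (M * T) - 1)) := by
  intro t ht
  have hT : 0 ≤ T := ht.1.trans ht.2
  have hB0 : 0 ≤ B := (abs_nonneg _).trans (hB t ht)
  -- The difference of the solutions starts at zero and solves the system for `k'` with source (k' -
  -- k) w, of size at most `d * B`. Since `1 ≤ M`, the constant `M` also serves for the first
  -- component.
  have key := norm_le_gronwallBound_of_norm_deriv_right_le (a := 0) (b := T) (δ := 0) (K := M)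
    (ε := d * B)
    (f := fun s => ((z s - w s, z₁ s - w₁ s) : ℝ × ℝ))
    (f' := fun s => ((z₁ s - w₁ s, -(k' s * z s) - -(k s * w s)) : ℝ × ℝ))
    ((h'.continuousOn_fst.sub h.continuousOn_fst).prodMk
      (h'.continuousOn_snd.sub h.continuousOn_snd))
    (fun s hs => hasDerivWithinAt_Ici_of_Icc
      (((h'.deriv_fst s ⟨hs.1, hs.2.le⟩).sub (h.deriv_fst s ⟨hs.1, hs.2.le⟩)).prodMk
        ((h'.deriv_snd s ⟨hs.1, hs.2.le⟩).sub (h.deriv_snd s ⟨hs.1, hs.2.le⟩))) hs)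
    (by simp [h.init_fst, h'.init_fst, h.init_snd, h'.init_snd])
    (fun s hs => by
      have hs' : s ∈ Icc 0 T := ⟨hs.1, hs.2.le⟩
      set N := ‖((z s - w s, z₁ s - w₁ s) : ℝ × ℝ)‖
      have hN : 0 ≤ N := norm_nonneg _
      have h1 : |z s - w s| ≤ N := le_max_left |z s - w s| |z₁ s - w₁ s|
      have h2 : |z₁ s - w₁ s| ≤ N := le_max_right |z s - w s| |z₁ s - w₁ s|
      have hdB : 0 ≤ d * B := mul_nonneg hd hB0
      refine max_le ?_ ?_
      · change |z₁ s - w₁ s| ≤ _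
        nlinarith
      · change |-(k' s * z s) - -(k s * w s)| ≤ _
        have : -(k' s * z s) - -(k s * w s) = -(k' s * (z s - w s) + (k' s - k s) * w s) := by ring
        rw [this, abs_neg]
        refine (abs_add_le _ _).trans (add_le_add ?_ ?_)
        · rw [abs_mul]
          exact mul_le_mul (hk' s hs') h1 (abs_nonneg _) (by linarith)
        · rw [abs_mul]
          exact mul_le_mul (hkk s hs') (hB s hs') (abs_nonneg _) hd) t ht
  have hbd : gronwallBound 0 M (d * B) (t - 0) ≤ d * (B / M * (Real.exp (M * T) - 1)) := by
    have hM0 : M ≠ 0 := by linarith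
    rw [gronwallBound_of_K_ne_0 hM0]
    have : Real.exp (M * (t - 0)) ≤ Real.exp (M * T) :=
      Real.exp_le_exp.2 (by nlinarith [ht.2])
    have h3 : 0 ≤ d * B / M := div_nonneg (mul_nonneg hd hB0) (by linarith)
    calc 0 * Real.exp (M * (t - 0)) + d * B / M * (Real.exp (M * (t - 0)) - 1)
        ≤ d * B / M * (Real.exp (M * T) - 1) := by
          rw [zero_mul, zero_add]
          exact mul_le_mul_of_nonneg_left (by linarith) h3
      _ = _ := by ring
  exact ⟨(le_max_left |z t - w t| |z₁ t - w₁ t|).trans (key.trans hbd),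
    (le_max_right |z t - w t| |z₁ t - w₁ t|).trans (key.trans hbd)⟩

/-- Uniqueness is continuous dependence with `d = 0`. -/
theorem eqOn (h : IsModeSolution T k w w₁) {z z₁ : ℝ → ℝ}
    (h' : IsModeSolution T k z z₁) (hk : ContinuousOn k (Icc 0 T)) :
    EqOn z w (Icc 0 T) ∧ EqOn z₁ w₁ (Icc 0 T) := by
  obtain ⟨M, hM⟩ := isCompact_Icc.exists_bound_of_continuousOn hk
  obtain ⟨B, hB⟩ := isCompact_Icc.exists_bound_of_continuousOn h.continuousOn_fst
  have key := h.dist_le h' (le_max_right M 1) le_rfl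
    (fun t ht => (hM t ht).trans (le_max_left _ _)) (fun t _ => by simp) hB
  simp only [zero_mul] at key
  exact ⟨fun t ht => sub_eq_zero.1 (abs_nonpos_iff.1 (key t ht).1),
    fun t ht => sub_eq_zero.1 (abs_nonpos_iff.1 (key t ht).2)⟩

/-- The hyperbolic energy decays at most exponentially. -/
theorem exp_mul_le_energy (h : IsModeSolution T k w w₁) {k₁ : ℝ → ℝ} {s L : ℝ} (hs : 0 ≤ s)
    (hL0 : 0 ≤ L)
    (hk : ContinuousOn k (Icc s T)) (hk₁ : ∀ t ∈ Ioo s T, HasDerivAt k (k₁ t) t)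
    (hL : ∀ t ∈ Ioo s T, |k₁ t| ≤ L * k t) :
    ∀ t ∈ Icc s T, Real.exp (-(L * (t - s))) * (w₁ s ^ 2 + k s * w s ^ 2) ≤
      w₁ t ^ 2 + k t * w t ^ 2 := by
  intro t ht
  have hsT : s ≤ T := ht.1.trans ht.2
  have hsub : Icc s T ⊆ Icc 0 T := Icc_subset_Icc_left hs
  have hw := h.continuousOn_fst.mono hsub
  have hw₁ := h.continuousOn_snd.mono hsub
  -- In the derivative of the energy w₁² + k w² the cross terms cancel and only k₁ w² survives; by
  -- |k₁| ≤ L k this is at least -L times the energy.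
  have hmono : MonotoneOn
      (fun t => Real.exp (L * (t - s)) * (w₁ t ^ 2 + k t * w t ^ 2)) (Icc s T) := by
    refine monotoneOn_of_hasDerivWithinAt_nonneg (convex_Icc s T) (f' := fun t =>
      Real.exp (L * (t - s)) * (L * 1) * (w₁ t ^ 2 + k t * w t ^ 2) +
      Real.exp (L * (t - s)) * (2 * w₁ t ^ 1 * -(k t * w t) +
        (k₁ t * w t ^ 2 + k t * (2 * w t ^ 1 * w₁ t)))) ?_ ?_ ?_
    · exact ContinuousOn.mul (by fun_prop) ((hw₁.pow 2).add (hk.mul (hw.pow 2)))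
    · intro x hx
      rw [interior_Icc] at hx ⊢
      have hx0 : Icc 0 T ∈ 𝓝 x := Icc_mem_nhds (hs.trans_lt hx.1) hx.2
      have d0 := (h.deriv_fst x (hsub (Ioo_subset_Icc_self hx))).hasDerivAt hx0
      have d1 := (h.deriv_snd x (hsub (Ioo_subset_Icc_self hx))).hasDerivAt hx0
      have de : HasDerivAt (fun t => Real.exp (L * (t - s)))
          (Real.exp (L * (x - s)) * (L * 1)) x :=
        (((hasDerivAt_id x).sub_const s).const_mul L).exp
      exact (de.mul ((d1.pow 2).add ((hk₁ x hx).mul (d0.pow 2)))).hasDerivWithinAt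
    · intro x hx
      rw [interior_Icc] at hx
      have h1 := abs_le.1 (hL x hx)
      have e : Real.exp (L * (x - s)) * (L * 1) * (w₁ x ^ 2 + k x * w x ^ 2) +
        Real.exp (L * (x - s)) * (2 * w₁ x ^ 1 * -(k x * w x) +
        (k₁ x * w x ^ 2 + k x * (2 * w x ^ 1 * w₁ x))) =
        Real.exp (L * (x - s)) * (L * w₁ x ^ 2 + (L * k x + k₁ x) * w x ^ 2) := by ring
      rw [e]
      have h3 : 0 ≤ (L * k x + k₁ x) * w x ^ 2 := mul_nonneg (by linarith) (sq_nonneg _)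
      have h4 : 0 ≤ L * w₁ x ^ 2 := mul_nonneg hL0 (sq_nonneg _)
      exact mul_nonneg (Real.exp_pos _).le (add_nonneg h4 h3)
  have h1 := hmono (left_mem_Icc.2 hsT) ht ht.1
  simp only [sub_self, mul_zero, Real.exp_zero, one_mul] at h1
  calc _ ≤ Real.exp (-(L * (t - s))) *
        (Real.exp (L * (t - s)) * (w₁ t ^ 2 + k t * w t ^ 2)) :=
        mul_le_mul_of_nonneg_left h1 (Real.exp_pos _).le
    _ = _ := by rw [← mul_assoc, ← Real.exp_add]; simp

end IsModeSolution

/-- Existence for the equation of a single mode. -/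
theorem exists_isModeSolution {T : ℝ} (hT : 0 ≤ T) {k : ℝ → ℝ} (hk : ContinuousOn k (Icc 0 T)) :
    ∃ w w₁ : ℝ → ℝ, IsModeSolution T k w w₁ := by
  obtain ⟨M', hM'⟩ := isCompact_Icc.exists_bound_of_continuousOn hk
  obtain ⟨M, hM1, hM⟩ : ∃ M : ℝ≥0, 1 ≤ M ∧ ∀ t ∈ Icc 0 T, |k t| ≤ M := by
    refine ⟨⟨max M' 1, zero_le_one.trans (le_max_right _ _)⟩, le_max_right M' 1, fun t ht =>
      (hM' t ht).trans (le_max_left _ _)⟩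
  have hM1' : (1 : ℝ) ≤ M := hM1
  -- Clipping the field at height `R` bounds it by `M * R`, so Picard–Lindelöf covers [0, T] in one
  -- step on a ball of radius `M * R * T`. `R` is the Grönwall bound for the clipped equation
  -- itself, so the clipping is never active along the solution.
  set R : ℝ≥0 := ⟨Real.exp (M * T), (Real.exp_pos _).le⟩ with hR
  have hR0 : (0 : ℝ) ≤ R := R.2
  set cl : ℝ → ℝ := fun x => max (-R) (min R x) with hcl
  have cl_abs : ∀ x, |cl x| ≤ |x| := by
    intro x
    simp only [hcl]
    rcases le_total x 0 with h | h
    · rw [min_eq_right (h.trans hR0), abs_of_nonpos h, abs_of_nonpos (max_le (by linarith) h)]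
      linarith [le_max_right (-(R : ℝ)) x]
    · rw [max_eq_right ((neg_nonpos.2 hR0).trans (le_min hR0 h)), abs_of_nonneg h,
        abs_of_nonneg (le_min hR0 h)]
      exact min_le_right _ _
  have cl_R : ∀ x, |cl x| ≤ R := by
    intro x
    exact abs_le.2 ⟨le_max_left _ _, max_le (by linarith) (min_le_left _ _)⟩
  have cl_eq : ∀ x : ℝ, |x| ≤ R → cl x = x := by
    intro x hx
    simp only [hcl]
    rw [min_eq_right (abs_le.1 hx).2, max_eq_right (abs_le.1 hx).1]
  have cl_lip : ∀ x y, |cl x - cl y| ≤ |x - y| := by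
    intro x y
    refine (abs_max_sub_max_le_max (-(R : ℝ)) _ _ _).trans ?_
    rw [sub_self, abs_zero, max_eq_right (abs_nonneg _)]
    refine (abs_min_sub_min_le_max (R : ℝ) _ _ _).trans ?_
    rw [sub_self, abs_zero, max_eq_right (abs_nonneg _)]
  set F : ℝ → ℝ × ℝ → ℝ × ℝ := fun t X => (cl X.2, -(k t * cl X.1)) with hF
  have hPL : IsPicardLindelof F (tmin := 0) (tmax := T) ⟨0, left_mem_Icc.2 hT⟩ ((0, 1) : ℝ × ℝ)
      (M * R * ⟨T, hT⟩) 0 (M * R) M := by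
    refine ⟨fun t ht => LipschitzWith.lipschitzOnWith (LipschitzWith.of_dist_le_mul ?_), ?_, ?_, ?_⟩
    · intro X Y
      have h1 : |X.1 - Y.1| ≤ dist X Y := le_max_left (dist X.1 Y.1) (dist X.2 Y.2)
      have h2 : |X.2 - Y.2| ≤ dist X Y := le_max_right (dist X.1 Y.1) (dist X.2 Y.2)
      refine max_le ?_ ?_
      · change |cl X.2 - cl Y.2| ≤ _
        nlinarith [cl_lip X.2 Y.2, dist_nonneg (x := X) (y := Y)]
      · change |-(k t * cl X.1) - -(k t * cl Y.1)| ≤ _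
        rw [show -(k t * cl X.1) - -(k t * cl Y.1) = -(k t * (cl X.1 - cl Y.1)) by ring, abs_neg,
          abs_mul]
        exact mul_le_mul (hM t ht) ((cl_lip _ _).trans h1) (abs_nonneg _) M.2
    · intro X _
      exact continuousOn_const.prodMk (hk.mul continuousOn_const).neg
    · intro t ht X _
      refine max_le ?_ ?_
      · change |cl X.2| ≤ M * R
        nlinarith [cl_R X.2]
      · change |-(k t * cl X.1)| ≤ M * R
        rw [abs_neg, abs_mul]
        exact mul_le_mul (hM t ht) (cl_R _) (abs_nonneg _) M.2
    · simp only [sub_zero, sub_self, NNReal.coe_mul, NNReal.coe_zero, max_eq_left hT]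
      exact le_rfl
  obtain ⟨α, hα0, hα⟩ := hPL.exists_eq_forall_mem_Icc_hasDerivWithinAt₀
  simp only at hα0
  have hb : ∀ t ∈ Icc 0 T, ‖α t‖ ≤ R := by
    intro t ht
    have key := norm_le_gronwallBound_of_norm_deriv_right_le (a := 0) (b := T) (δ := 1) (K := M)
      (ε := 0) (f := α) (f' := fun s => F s (α s))
      (fun s hs => (hα s hs).continuousWithinAt)
      (fun s hs => hasDerivWithinAt_Ici_of_Icc (hα s ⟨hs.1, hs.2.le⟩) hs)
      (by rw [hα0]; exact max_le (by simp) (by simp))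
      (fun s hs => by
        have h1 : |(α s).1| ≤ ‖α s‖ := le_max_left |(α s).1| |(α s).2|
        have h2 : |(α s).2| ≤ ‖α s‖ := le_max_right |(α s).1| |(α s).2|
        rw [add_zero]
        refine max_le ?_ ?_
        · change |cl (α s).2| ≤ _
          nlinarith [cl_abs (α s).2, norm_nonneg (α s)]
        · change |-(k s * cl (α s).1)| ≤ _
          rw [abs_neg, abs_mul]
          exact mul_le_mul (hM s ⟨hs.1, hs.2.le⟩) ((cl_abs _).trans h1) (abs_nonneg _) M.2) t ht
    rw [gronwallBound_ε0, one_mul, sub_zero] at key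
    exact key.trans (Real.exp_le_exp.2 (mul_le_mul_of_nonneg_left ht.2 M.2))
  refine ⟨fun t => (α t).1, fun t => (α t).2, fun t ht => ?_, fun t ht => ?_, ?_, ?_⟩
  · have h2 : |(α t).2| ≤ ‖α t‖ := le_max_right |(α t).1| |(α t).2|
    have := (hα t ht).hasFDerivWithinAt.fst.hasDerivWithinAt
    simpa [hF, cl_eq _ (h2.trans (hb t ht))] using this
  · have h1 : |(α t).1| ≤ ‖α t‖ := le_max_left |(α t).1| |(α t).2|
    have := (hα t ht).hasFDerivWithinAt.snd.hasDerivWithinAt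
    simpa [hF, cl_eq _ (h1.trans (hb t ht))] using this
  · simp [hα0]
  · simp [hα0]

/-! ### A resonant perturbation of the harmonic oscillator -/

/-- At an endpoint f and f' both vanish, so the truncation is dominated by f, which is o(z - y)
there. -/
theorem hasDerivAt_indicator_Icc {f f' : ℝ → ℝ} {a b : ℝ}
    (hf : ∀ x ∈ Icc a b, HasDerivAt f (f' x) x) (ha : f a = 0) (hb : f b = 0) (ha' : f' a = 0)
    (hb' : f' b = 0) (x : ℝ) :
    HasDerivAt (indicator (Icc a b) f) (indicator (Icc a b) f' x) x := by
  have hend : ∀ y ∈ Icc a b, f y = 0 → f' y = 0 →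
      HasDerivAt (indicator (Icc a b) f) (indicator (Icc a b) f' y) y := by
    intro y hy h0 h1
    have h := hf y hy
    rw [h1] at h
    rw [indicator_of_mem hy, h1]
    rw [hasDerivAt_iff_isLittleO] at h ⊢
    refine Asymptotics.IsBigO.trans_isLittleO (Asymptotics.IsBigO.of_bound 1 ?_) h
    refine Eventually.of_forall fun z => ?_
    simp only [indicator_of_mem hy, h0, sub_zero, smul_zero, one_mul]
    exact norm_indicator_le_norm_self _ _
  by_cases hx : x ∈ Icc a b
  · rcases hx.1.eq_or_lt with rfl | h1
    · exact hend _ hx ha ha'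
    rcases hx.2.eq_or_lt with rfl | h2
    · exact hend _ hx hb hb'
    rw [indicator_of_mem hx]
    refine (hf x hx).congr_of_eventuallyEq ?_
    filter_upwards [Icc_mem_nhds h1 h2] with y hy using indicator_of_mem hy f
  · rw [indicator_of_notMem hx]
    refine (hasDerivAt_const x (0 : ℝ)).congr_of_eventuallyEq ?_
    filter_upwards [isClosed_Icc.isOpen_compl.mem_nhds hx] with y hy
    exact indicator_of_notMem hy f

/-- The two expressions are the resonant perturbation and its derivative. After multiplication by x
one factor G remains outside; every further G is paired with a 1/x and absorbed by G ≤ x. The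
constants are 8 = 6 + 2 and 46 = 24 + 6 + 12 + 4. -/
theorem resonance_bounds {G x : ℝ} (hG : 1 ≤ G) (hx3 : 3 ≤ x) (hxG : G ≤ x) :
    |-(G * (6 * (Real.sin x ^ 3 * Real.cos x) / x +
      (G * Real.sin x ^ 8 - Real.sin x ^ 4) / x ^ 2))| * x ≤ 8 * G ∧
    |-(G * (6 * (3 * Real.sin x ^ 2 * Real.cos x ^ 2 - Real.sin x ^ 4) / x -
      6 * (Real.sin x ^ 3 * Real.cos x) / x ^ 2 +
      (8 * G * Real.sin x ^ 7 * Real.cos x - 4 * Real.sin x ^ 3 * Real.cos x) / x ^ 2 -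
      2 * (G * Real.sin x ^ 8 - Real.sin x ^ 4) / x ^ 3))| * x ≤ 46 * G := by
  have hx0 : 0 < x := by linarith
  have hs := Real.abs_sin_le_one x
  have hc := Real.abs_cos_le_one x
  have hsp : ∀ k, |Real.sin x| ^ k ≤ 1 := fun k => pow_le_one₀ (abs_nonneg _) hs
  have hsc : ∀ k, |Real.sin x ^ k * Real.cos x| ≤ 1 := fun k => by
    rw [abs_mul, abs_pow]
    exact mul_le_one₀ (hsp k) (abs_nonneg _) hc
  have hsk : ∀ k, |Real.sin x ^ k| ≤ 1 := fun k => by rw [abs_pow]; exact hsp k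
  have h3 := abs_le.1 (hsc 3)
  have h7 := abs_le.1 (hsc 7)
  have h4 := abs_le.1 (hsk 4)
  have h8 := abs_le.1 (hsk 8)
  have h22 : |Real.sin x ^ 2 * Real.cos x ^ 2| ≤ 1 := by
    rw [abs_mul, abs_pow, abs_pow]
    exact mul_le_one₀ (hsp 2) (by positivity) (pow_le_one₀ (abs_nonneg _) hc)
  have h22' := abs_le.1 h22
  have hG0 : 0 ≤ G := by linarith
  set s3 := Real.sin x ^ 3 * Real.cos x
  set s7 := Real.sin x ^ 7 * Real.cos x
  set s4 := Real.sin x ^ 4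
  set s8 := Real.sin x ^ 8
  set s22 := Real.sin x ^ 2 * Real.cos x ^ 2
  have b1 : |G * s8 - s4| ≤ 2 * x := abs_le.2 ⟨by nlinarith, by nlinarith⟩
  constructor
  · have e : -(G * (6 * (Real.sin x ^ 3 * Real.cos x) / x +
  (G * Real.sin x ^ 8 - Real.sin x ^ 4) / x ^ 2)) * x = -(G * (6 * s3 + (G * s8 - s4) / x)) := by
      simp only [s3, s4, s8]
      field_simp
    rw [show |-(G * (6 * (Real.sin x ^ 3 * Real.cos x) / x +
  (G * Real.sin x ^ 8 - Real.sin x ^ 4) / x ^ 2))| * x = |-(G * (6 * (Real.sin x ^ 3 * Real.cos x) / x +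
  (G * Real.sin x ^ 8 - Real.sin x ^ 4) / x ^ 2)) * x| by rw [abs_mul, abs_of_pos hx0], e, abs_neg, abs_mul,
      abs_of_nonneg hG0, mul_comm]
    refine mul_le_mul_of_nonneg_right ?_ hG0
    refine (abs_add_le _ _).trans ?_
    have : |(G * s8 - s4) / x| ≤ 2 := by
      rw [abs_div, abs_of_pos hx0, div_le_iff₀ hx0]
      exact b1
    have : |6 * s3| ≤ 6 := abs_le.2 ⟨by linarith, by linarith⟩
    linarith
  · have e : -(G * (6 * (3 * Real.sin x ^ 2 * Real.cos x ^ 2 - Real.sin x ^ 4) / x -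
  6 * (Real.sin x ^ 3 * Real.cos x) / x ^ 2 +
  (8 * G * Real.sin x ^ 7 * Real.cos x - 4 * Real.sin x ^ 3 * Real.cos x) / x ^ 2 -
  2 * (G * Real.sin x ^ 8 - Real.sin x ^ 4) / x ^ 3)) * x = -(G * (6 * (3 * s22 - s4) + (-(6 * s3) / x) +
        (8 * G * s7 - 4 * s3) / x + (-(2 * (G * s8 - s4)) / x) / x)) := by
      simp only [s3, s4, s8, s7, s22]
      field_simp
      ring
    rw [show |-(G * (6 * (3 * Real.sin x ^ 2 * Real.cos x ^ 2 - Real.sin x ^ 4) / x -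
  6 * (Real.sin x ^ 3 * Real.cos x) / x ^ 2 +
  (8 * G * Real.sin x ^ 7 * Real.cos x - 4 * Real.sin x ^ 3 * Real.cos x) / x ^ 2 -
  2 * (G * Real.sin x ^ 8 - Real.sin x ^ 4) / x ^ 3))| * x = |-(G * (6 * (3 * Real.sin x ^ 2 * Real.cos x ^ 2 - Real.sin x ^ 4) / x -
  6 * (Real.sin x ^ 3 * Real.cos x) / x ^ 2 +
  (8 * G * Real.sin x ^ 7 * Real.cos x - 4 * Real.sin x ^ 3 * Real.cos x) / x ^ 2 -
  2 * (G * Real.sin x ^ 8 - Real.sin x ^ 4) / x ^ 3)) * x| by rw [abs_mul, abs_of_pos hx0], e, abs_neg, abs_mul,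
      abs_of_nonneg hG0, mul_comm]
    refine mul_le_mul_of_nonneg_right ?_ hG0
    have c1 : |6 * (3 * s22 - s4)| ≤ 24 := abs_le.2 ⟨by linarith, by linarith⟩
    have c2 : |-(6 * s3) / x| ≤ 6 := by
      rw [abs_div, abs_of_pos hx0, div_le_iff₀ hx0]
      exact abs_le.2 ⟨by linarith, by linarith⟩
    have c3 : |(8 * G * s7 - 4 * s3) / x| ≤ 12 := by
      rw [abs_div, abs_of_pos hx0, div_le_iff₀ hx0]
      exact abs_le.2 ⟨by nlinarith, by nlinarith⟩
    have c4 : |(-(2 * (G * s8 - s4)) / x) / x| ≤ 4 := by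
      have : |-(2 * (G * s8 - s4)) / x| ≤ 4 := by
        rw [abs_div, abs_of_pos hx0, div_le_iff₀ hx0, abs_neg, abs_mul, abs_two]
        linarith
      rw [abs_div, abs_of_pos hx0, div_le_iff₀ hx0]
      linarith
    refine (abs_add_le _ _).trans ?_
    have := abs_add_le (6 * (3 * s22 - s4) + (-(6 * s3) / x)) ((8 * G * s7 - 4 * s3) / x)
    have := abs_add_le (6 * (3 * s22 - s4)) (-(6 * s3) / x)
    linarith

/-- A perturbation `q` of class `C¹`, supported in `[m π, n π]`, of size `O(Γ / x)` together with
its derivative, such that the solution `W` of `W'' + (1 + q) W = 0` with initial data `(0, 1)`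
grows by the factor `(n / m) ^ (Γ / 4)`. -/
theorem exists_resonance {G : ℝ} (hG : 1 ≤ G) {m n : ℕ} (hm : G ≤ m) (hmn : m < n) :
    ∃ q q' W W' : ℝ → ℝ, (∀ x, HasDerivAt q (q' x) x) ∧ Continuous q' ∧
      (∀ x, x ∉ Icc (m * Real.pi) (n * Real.pi) → q x = 0 ∧ q' x = 0) ∧
      (∀ x ∈ Icc (m * Real.pi) (n * Real.pi), |q x| * x ≤ 8 * G ∧ |q' x| * x ≤ 46 * G) ∧
      (∀ x, HasDerivAt W (W' x) x) ∧ (∀ x, HasDerivAt W' (-((1 + q x) * W x)) x) ∧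
      W 0 = 0 ∧ W' 0 = 1 ∧ W (n * Real.pi) = 0 ∧
      Real.exp (G / 4 * Real.log (n / m)) ≤ |W' (n * Real.pi)| := by
  have hpi := Real.pi_gt_three
  have hm1 : (1 : ℝ) ≤ m := hG.trans hm
  have hmn' : (m : ℝ) < n := by exact_mod_cast hmn
  set a : ℝ := m * Real.pi with ha
  set b : ℝ := n * Real.pi with hb
  have hab : a < b := mul_lt_mul_of_pos_right hmn' Real.pi_pos
  have ha3 : 3 ≤ a := by nlinarith
  have haG : G ≤ a := by nlinarith
  have hsa : Real.sin a = 0 := Real.sin_nat_mul_pi m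
  have hsb : Real.sin b = 0 := Real.sin_nat_mul_pi n
  have hpos : ∀ x ∈ Icc a b, x ≠ 0 := fun x hx => by have := hx.1; linarith
  -- With W = sin x · exp P and P' = η, the equation forces q = -(2η cot x + η' + η²). For η = G
  -- sin⁴x / x this is `q₀`. The fourth power leaves a factor sin³x in q and sin²x in q', so both
  -- vanish at multiples of π and the extension by zero is C¹.
  set e₀ : ℝ → ℝ := fun x => G * (Real.sin x ^ 4 / x) with he₀
  set e₁ : ℝ → ℝ := fun x => G * (4 * (Real.sin x ^ 3 * Real.cos x) / x - Real.sin x ^ 4 / x ^ 2)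
    with he₁
  set q₀ : ℝ → ℝ := fun x => -(G * (6 * (Real.sin x ^ 3 * Real.cos x) / x +
    (G * Real.sin x ^ 8 - Real.sin x ^ 4) / x ^ 2)) with hq₀
  set q₁ : ℝ → ℝ := fun x => -(G * (6 * (3 * Real.sin x ^ 2 * Real.cos x ^ 2 - Real.sin x ^ 4) / x -
    6 * (Real.sin x ^ 3 * Real.cos x) / x ^ 2 +
    (8 * G * Real.sin x ^ 7 * Real.cos x - 4 * Real.sin x ^ 3 * Real.cos x) / x ^ 2 -
    2 * (G * Real.sin x ^ 8 - Real.sin x ^ 4) / x ^ 3)) with hq₁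
  have de₀ : ∀ x ∈ Icc a b, HasDerivAt e₀ (e₁ x) x := by
    intro x hx
    have hx0 := hpos x hx
    refine HasDerivAt.congr_deriv (((((Real.hasDerivAt_sin x).pow 4).div (hasDerivAt_id x) hx0).const_mul G)) ?_
    simp only [he₁, id, Pi.pow_apply]
    field_simp
    push_cast
    ring
  have dq₀ : ∀ x ∈ Icc a b, HasDerivAt q₀ (q₁ x) x := by
    intro x hx
    have hx0 := hpos x hx
    have hs := Real.hasDerivAt_sin x
    have hc := Real.hasDerivAt_cos x
    refine HasDerivAt.congr_deriv (((((((hs.pow 3).mul hc).const_mul 6).div (hasDerivAt_id x) hx0).add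
      ((((hs.pow 8).const_mul G).sub (hs.pow 4)).div ((hasDerivAt_id x).pow 2)
        (pow_ne_zero 2 hx0))).const_mul G).neg) ?_
    simp only [hq₁, id, Pi.mul_apply, Pi.pow_apply, Pi.sub_apply]
    field_simp
    push_cast
    ring
  have dη := hasDerivAt_indicator_Icc de₀ (by simp [he₀, hsa]) (by simp [he₀, hsb])
    (by simp [he₁, hsa]) (by simp [he₁, hsb])
  have dq := hasDerivAt_indicator_Icc dq₀ (by simp [hq₀, hsa]) (by simp [hq₀, hsb])
    (by simp [hq₁, hsa]) (by simp [hq₁, hsb])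
  set η := indicator (Icc a b) e₀ with hη
  have cη : Continuous η := continuous_iff_continuousAt.2 fun x => (dη x).continuousAt
  set P : ℝ → ℝ := fun x => ∫ y in (0 : ℝ)..x, η y with hP
  have dP : ∀ x, HasDerivAt P (η x) x := fun x =>
    intervalIntegral.integral_hasDerivAt_right (cη.intervalIntegrable _ _)
      (cη.stronglyMeasurableAtFilter _ _) cη.continuousAt
  have hηa : ∀ x ≤ a, η x = 0 := by
    intro x hx
    rcases hx.eq_or_lt with rfl | hx
    · rw [hη, indicator_of_mem (left_mem_Icc.2 hab.le)]
      simp [he₀, hsa]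
    · exact indicator_of_notMem (fun h => absurd h.1 (not_le.2 hx)) _
  have hPa : P a = 0 := by
    have : ∫ y in (0 : ℝ)..a, η y = ∫ y in (0 : ℝ)..a, (0 : ℝ) :=
      intervalIntegral.integral_congr fun y hy => by
        rw [uIcc_of_le (by linarith)] at hy
        exact hηa y hy.2
    simp [hP, this]
  have hPb : G / 4 * Real.log (n / m) ≤ P b := by
    -- Integration by parts: ∫ sin⁴x / x equals the increment of S/x plus ∫ S/x², where S is a
    -- primitive of sin⁴. At multiples of π the ratio S/x is 3/8, so the boundary terms cancel. For
    -- x ≥ 3 one has S ≥ x/4, which gives the logarithm with the factor 1/4.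
    set S : ℝ → ℝ := fun x => 3 * x / 8 - Real.sin (2 * x) / 4 + Real.sin (4 * x) / 32 with hS
    have dS : ∀ x, HasDerivAt S (Real.sin x ^ 4) x := by
      intro x
      have h2 : HasDerivAt (fun x => Real.sin (2 * x)) (Real.cos (2 * x) * (2 * 1)) x :=
        ((hasDerivAt_id x).const_mul 2).sin
      have h4 : HasDerivAt (fun x => Real.sin (4 * x)) (Real.cos (4 * x) * (4 * 1)) x :=
        ((hasDerivAt_id x).const_mul 4).sin
      refine HasDerivAt.congr_deriv (((((hasDerivAt_id x).const_mul 3).div_const 8).sub (h2.div_const 4)).add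
        (h4.div_const 32)) ?_
      rw [show 4 * x = 2 * (2 * x) by ring, Real.cos_two_mul (2 * x), Real.cos_two_mul,
        Real.cos_sq']
      ring
    have hSe : ∀ k : ℕ, S (k * Real.pi) = 3 * (k * Real.pi) / 8 := by
      intro k
      have h2 : Real.sin (2 * (k * Real.pi)) = 0 := by
        rw [show 2 * ((k : ℝ) * Real.pi) = ((2 * k : ℕ) : ℝ) * Real.pi by push_cast; ring]
        exact Real.sin_nat_mul_pi _
      have h4 : Real.sin (4 * (k * Real.pi)) = 0 := by
        rw [show 4 * ((k : ℝ) * Real.pi) = ((4 * k : ℕ) : ℝ) * Real.pi by push_cast; ring]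
        exact Real.sin_nat_mul_pi _
      simp [hS, h2, h4]
    have hmono : MonotoneOn (fun x => P x - G * (S x / x + 1 / 4 * Real.log x)) (Icc a b) := by
      have hd : ∀ x ∈ Icc a b, HasDerivAt (fun x => P x - G * (S x / x + 1 / 4 * Real.log x))
          (η x - G * ((Real.sin x ^ 4 * x - S x * 1) / x ^ 2 + 1 / 4 * x⁻¹)) x := fun x hx =>
        (dP x).sub ((((dS x).div (hasDerivAt_id x) (hpos x hx)).add
          ((Real.hasDerivAt_log (hpos x hx)).const_mul (1 / 4))).const_mul G)
      refine monotoneOn_of_hasDerivWithinAt_nonneg (convex_Icc a b)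
        (fun x hx => (hd x hx).continuousAt.continuousWithinAt)
        (fun x hx => (hd x (interior_subset hx)).hasDerivWithinAt) fun x hx => ?_
      have hx := interior_subset hx
      have hx0 := hpos x hx
      have hxa := hx.1
      rw [hη, indicator_of_mem hx]
      have : e₀ x - G * ((Real.sin x ^ 4 * x - S x * 1) / x ^ 2 + 1 / 4 * x⁻¹) =
          G * (S x - x / 4) / x ^ 2 := by
        simp only [he₀]
        field_simp
        ring
      rw [this]
      refine div_nonneg (mul_nonneg (by linarith) ?_) (sq_nonneg _)
      have := Real.sin_le_one (2 * x)
      have := Real.neg_one_le_sin (4 * x)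
      simp only [hS]
      linarith
    have h := hmono (left_mem_Icc.2 hab.le) (right_mem_Icc.2 hab.le) hab.le
    have e1 : S a / a = 3 / 8 := by
      rw [ha, hSe, ← ha]
      have : a ≠ 0 := by linarith
      field_simp
    have e2 : S b / b = 3 / 8 := by
      rw [hb, hSe, ← hb]
      have : b ≠ 0 := by linarith
      field_simp
    have e3 : Real.log b - Real.log a = Real.log (n / m) := by
      rw [← Real.log_div (by linarith) (by linarith), ha, hb,
        mul_div_mul_right _ _ Real.pi_ne_zero]
    simp only [hPa, e1, e2] at h
    rw [← e3]
    linarith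
  refine ⟨indicator (Icc a b) q₀, indicator (Icc a b) q₁, fun x => Real.sin x * Real.exp (P x),
    fun x => (Real.cos x + η x * Real.sin x) * Real.exp (P x), dq, ?_, ?_, ?_, ?_, ?_, ?_, ?_, ?_,
    ?_⟩
  · refine continuous_indicator ?_ ?_
    · intro x hx
      rw [frontier_Icc hab.le] at hx
      rcases hx with rfl | rfl <;> simp [hq₁, hsa, hsb]
    · rw [isClosed_Icc.closure_eq]
      refine ContinuousOn.neg (continuousOn_const.mul ?_)
      refine ContinuousOn.sub (ContinuousOn.add (ContinuousOn.sub ?_ ?_) ?_) ?_ <;>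
        refine ContinuousOn.div (by fun_prop) (by fun_prop) fun x hx => ?_
      · exact hpos x hx
      all_goals exact pow_ne_zero _ (hpos x hx)
  · intro x hx
    exact ⟨indicator_of_notMem hx _, indicator_of_notMem hx _⟩
  · intro x hx
    rw [indicator_of_mem hx, indicator_of_mem hx]
    have hx3 : 3 ≤ x := ha3.trans hx.1
    have hxG : G ≤ x := haG.trans hx.1
    have hx0 : 0 < x := by linarith
    exact resonance_bounds hG hx3 hxG
  · intro x
    refine HasDerivAt.congr_deriv ((Real.hasDerivAt_sin x).mul (dP x).exp) ?_
    ring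
  · intro x
    refine HasDerivAt.congr_deriv (((Real.hasDerivAt_cos x).add ((dη x).mul (Real.hasDerivAt_sin x))).mul (dP x).exp) ?_
    by_cases hx : x ∈ Icc a b
    · have hx0 := hpos x hx
      simp only [hη, indicator_of_mem hx, Pi.add_apply, Pi.mul_apply]
      simp only [hq₀, he₀, he₁]
      field_simp
      ring
    · simp only [hη, indicator_of_notMem hx, Pi.add_apply, Pi.mul_apply]
      ring
  · simp
  · have : P 0 = 0 := by simp [hP]
    simp [this]
  · simp [hsb]
  · simp only [hsb, mul_zero, add_zero, abs_mul]
    rw [Real.abs_exp, hb, Real.cos_nat_mul_pi, abs_pow, abs_neg, abs_one, one_pow, one_mul]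
    exact Real.exp_le_exp.2 hPb

/-! ### The metric space of propagation speeds -/

namespace PS1

variable {T₀ : ℝ} {hT : 0 < T₀} {μ₁ μ₂ : ℝ} {ω : ℝ → ℝ}

theorem exists_of_hasDerivWithinAt {f f' : ℝ → ℝ} (hf : ContinuousOn f (Icc 0 T₀))
    (hd : ∀ t ∈ Ioc 0 T₀, HasDerivWithinAt f (f' t) (Ioc 0 T₀) t)
    (hf' : ContinuousOn f' (Ioc 0 T₀)) (hb : ∀ t ∈ Ioo 0 T₀, μ₁ ≤ f t ∧ f t ≤ μ₂)
    (hω : ∀ t ∈ Ioc 0 T₀, |f' t| ≤ ω t / t) :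
    ∃ c : PS1 hT μ₁ μ₂ ω, EqOn c.toFun f (Icc 0 T₀) ∧ EqOn c.deriv' f' (Ioc 0 T₀) := by
  set g := indicator (Icc 0 T₀) f with hg
  have hgf : EqOn g f (Icc 0 T₀) := fun t ht => indicator_of_mem ht f
  have hgd : ∀ t ∈ Ioc 0 T₀, HasDerivWithinAt g (f' t) (Ioc 0 T₀) t := fun t ht =>
    (hd t ht).congr_of_mem (fun s hs => hgf (Ioc_subset_Icc_self hs)) ht
  have hu : UniqueDiffOn ℝ (Ioc 0 T₀) := uniqueDiffOn_Ioc 0 T₀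
  have hg' : EqOn (derivWithin g (Ioc 0 T₀)) f' (Ioc 0 T₀) := fun t ht =>
    (hgd t ht).derivWithin (hu t ht)
  refine ⟨⟨g, fun t ht => indicator_of_notMem ht f, hf.congr hgf, ?_, fun t ht => ?_,
    fun t ht => ?_⟩, hgf, hg'⟩
  · rw [contDiffOn_one_iff_derivWithin hu]
    exact ⟨fun t ht => (hgd t ht).differentiableWithinAt, hf'.congr hg'⟩
  · rw [hgf (Ioo_subset_Icc_self ht)]
    exact hb t ht
  · rw [hg' ht]
    exact hω t ht

theorem hasDerivWithinAt (c : PS1 hT μ₁ μ₂ ω) {t : ℝ} (ht : t ∈ Ioc 0 T₀) :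
    HasDerivWithinAt c.toFun (c.deriv' t) (Ioc 0 T₀) t :=
  ((c.contDiffOn.differentiableOn one_ne_zero) t ht).hasDerivWithinAt

theorem hasDerivAt (c : PS1 hT μ₁ μ₂ ω) {t : ℝ} (ht : t ∈ Ioo 0 T₀) :
    HasDerivAt c.toFun (c.deriv' t) t :=
  (c.hasDerivWithinAt (Ioo_subset_Ioc_self ht)).hasDerivAt (Ioc_mem_nhds ht.1 ht.2)

theorem continuousOn_deriv' (c : PS1 hT μ₁ μ₂ ω) : ContinuousOn c.deriv' (Ioc 0 T₀) :=
  ((contDiffOn_one_iff_derivWithin (uniqueDiffOn_Ioc 0 T₀)).1 c.contDiffOn).2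

theorem mem_Icc (c : PS1 hT μ₁ μ₂ ω) {t : ℝ} (ht : t ∈ Icc 0 T₀) : c.toFun t ∈ Icc μ₁ μ₂ := by
  have hmaps : MapsTo c.toFun (Ioo 0 T₀) (Icc μ₁ μ₂) := fun s hs => c.hyperbolic s hs
  have hcl : closure (Ioo 0 T₀) = Icc 0 T₀ := closure_Ioo hT.ne
  have := hmaps.closure_of_continuousOn (by rw [hcl]; exact c.continuousOn)
  rw [hcl, isClosed_Icc.closure_eq] at this
  exact this ht

theorem dist_le {c₁ c₂ : PS1 hT μ₁ μ₂ ω} {a b : ℝ}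
    (ha : ∀ t ∈ Ioo 0 T₀, |c₁.toFun t - c₂.toFun t| ≤ a)
    (hb : ∀ t ∈ Ioo 0 T₀, t ^ 2 / ω t * |c₁.deriv' t - c₂.deriv' t| ≤ b) :
    dist c₁ c₂ ≤ a + b := by
  have : Nonempty (Ioo (0 : ℝ) T₀) := ⟨⟨T₀ / 2, by constructor <;> linarith⟩⟩
  exact add_le_add (ciSup_le fun t => ha t t.2) (ciSup_le fun t => hb t t.2)

theorem abs_sub_le_dist (c₁ c₂ : PS1 hT μ₁ μ₂ ω) {t : ℝ} (ht : t ∈ Icc 0 T₀) :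
    |c₁.toFun t - c₂.toFun t| ≤ dist c₁ c₂ := by
  have h0 : 0 ≤ ⨆ t : Ioo (0 : ℝ) T₀, (t : ℝ) ^ 2 / ω t * |c₁.deriv' t - c₂.deriv' t| :=
    Real.iSup_nonneg fun t => mul_nonneg (div_nonneg (sq_nonneg _) (c₁.omega_nonneg t))
      (abs_nonneg _)
  have hmaps : MapsTo (fun t => c₁.toFun t - c₂.toFun t) (Ioo 0 T₀)
      (Icc (-dist c₁ c₂) (dist c₁ c₂)) := fun s hs => by
    refine abs_le.1 ?_
    rw [dist_def]
    have := le_ciSup (bddAbove_fun c₁ c₂) ⟨s, hs⟩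
    simp only at this
    linarith
  have hcl : closure (Ioo 0 T₀) = Icc 0 T₀ := closure_Ioo hT.ne
  have := hmaps.closure_of_continuousOn
    (by rw [hcl]; exact c₁.continuousOn.sub c₂.continuousOn)
  rw [hcl, isClosed_Icc.closure_eq] at this
  exact abs_le.2 (this ht)

theorem mul_abs_sub_deriv_le_dist (c₁ c₂ : PS1 hT μ₁ μ₂ ω) {t : ℝ} (ht : t ∈ Ioo 0 T₀) :
    t ^ 2 / ω t * |c₁.deriv' t - c₂.deriv' t| ≤ dist c₁ c₂ := by
  have h0 : 0 ≤ ⨆ t : Ioo (0 : ℝ) T₀, |c₁.toFun t - c₂.toFun t| :=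
    Real.iSup_nonneg fun t => abs_nonneg _
  rw [dist_def]
  have := le_ciSup (bddAbove_deriv c₁ c₂) ⟨t, ht⟩
  simp only at this
  linarith

/-- The weight t²/ω(t) is nondecreasing, so its value at t bounds it from below on [t, T₀].
Convergence in the distance is thus C¹ convergence away from the origin; continuity supplies the
endpoint T₀, which the supremum omits. -/
theorem abs_sub_deriv_le (hω_pos : ∀ t ∈ Ioc 0 T₀, 0 < ω t) (hω_anti : AntitoneOn ω (Ioc 0 T₀))
    (c₁ c₂ : PS1 hT μ₁ μ₂ ω) {t s : ℝ} (ht : t ∈ Ioo 0 T₀) (hs : s ∈ Icc t T₀) :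
    |c₁.deriv' s - c₂.deriv' s| ≤ ω t / t ^ 2 * dist c₁ c₂ := by
  have hmaps : MapsTo (fun t => c₁.deriv' t - c₂.deriv' t) (Ioo t T₀)
      (Icc (-(ω t / t ^ 2 * dist c₁ c₂)) (ω t / t ^ 2 * dist c₁ c₂)) := fun r hr => by
    refine abs_le.1 ?_
    have hr0 : r ∈ Ioo 0 T₀ := ⟨ht.1.trans hr.1, hr.2⟩
    have hωt := hω_pos t (Ioo_subset_Ioc_self ht)
    have hωr := hω_pos r (Ioo_subset_Ioc_self hr0)
    have h1 := mul_abs_sub_deriv_le_dist c₁ c₂ hr0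
    have h2 : t ^ 2 / ω t ≤ r ^ 2 / ω r :=
      div_le_div₀ (sq_nonneg _) (pow_le_pow_left₀ ht.1.le hr.1.le 2) hωr
        (hω_anti (Ioo_subset_Ioc_self ht) (Ioo_subset_Ioc_self hr0) hr.1.le)
    have h3 := (mul_le_mul_of_nonneg_right h2 (abs_nonneg (c₁.deriv' r - c₂.deriv' r))).trans h1
    have ht0 := ht.1
    rw [div_mul_eq_mul_div, div_le_iff₀ hωt] at h3
    rw [div_mul_eq_mul_div, le_div_iff₀ (by positivity)]
    linarith
  have hcl : closure (Ioo t T₀) = Icc t T₀ := closure_Ioo ht.2.ne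
  have hsub : Icc t T₀ ⊆ Ioc 0 T₀ := fun r hr => ⟨ht.1.trans_le hr.1, hr.2⟩
  have := hmaps.closure_of_continuousOn
    (by rw [hcl]; exact (c₁.continuousOn_deriv'.sub c₂.continuousOn_deriv').mono hsub)
  rw [hcl, isClosed_Icc.closure_eq] at this
  exact abs_le.2 (this hs)

/-- A Cauchy sequence converges uniformly on [0, T₀], and its derivatives converge uniformly on
every [t, T₀] with t > 0. The constraints are pointwise closed conditions, so the limit satisfies
them. -/
theorem completeSpace (hω_pos : ∀ t ∈ Ioc 0 T₀, 0 < ω t) (hω_anti : AntitoneOn ω (Ioc 0 T₀)) :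
    CompleteSpace (PS1 hT μ₁ μ₂ ω) := by
  refine Metric.complete_of_cauchySeq_tendsto fun u hu => ?_
  obtain ⟨b, hb0, hb, hblim⟩ := cauchySeq_iff_le_tendsto_0.1 hu
  have hf : ∀ t, ∃ y, t ∈ Icc 0 T₀ → Tendsto (fun n => (u n).toFun t) atTop (𝓝 y) := by
    intro t
    by_cases ht : t ∈ Icc 0 T₀
    · have : CauchySeq fun n => (u n).toFun t := cauchySeq_iff_le_tendsto_0.2
        ⟨b, hb0, fun n m N hn hm => (abs_sub_le_dist _ _ ht).trans (hb n m N hn hm), hblim⟩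
      obtain ⟨y, hy⟩ := cauchySeq_tendsto_of_complete this
      exact ⟨y, fun _ => hy⟩
    · exact ⟨0, fun h => absurd h ht⟩
  choose f hf using hf
  have hscale : ∀ t ∈ Ioo 0 T₀, ∀ s ∈ Icc t T₀, ∀ n m N : ℕ, N ≤ n → N ≤ m →
      dist ((u n).deriv' s) ((u m).deriv' s) ≤ ω t / t ^ 2 * b N := by
    intro t ht s hs n m N hn hm
    refine (abs_sub_deriv_le hω_pos hω_anti _ _ ht hs).trans ?_
    exact mul_le_mul_of_nonneg_left (hb n m N hn hm)
      (div_nonneg (hω_pos t (Ioo_subset_Ioc_self ht)).le (sq_nonneg _))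
  have hbs : ∀ K : ℝ, Tendsto (fun n => K * b n) atTop (𝓝 0) := fun K => by
    simpa using hblim.const_mul K
  have hleft : ∀ s ∈ Ioc 0 T₀, ∃ t ∈ Ioo 0 T₀, t < s := fun s hs =>
    ⟨s / 2, ⟨half_pos hs.1, (half_lt_self hs.1).trans_le hs.2⟩, half_lt_self hs.1⟩
  have hd : ∀ s, ∃ y, s ∈ Ioc 0 T₀ → Tendsto (fun n => (u n).deriv' s) atTop (𝓝 y) := by
    intro s
    by_cases hs : s ∈ Ioc 0 T₀
    · obtain ⟨t, ht, hts⟩ := hleft s hs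
      have hK : 0 ≤ ω t / t ^ 2 := div_nonneg (hω_pos t (Ioo_subset_Ioc_self ht)).le (sq_nonneg _)
      have : CauchySeq fun n => (u n).deriv' s := cauchySeq_iff_le_tendsto_0.2
        ⟨fun n => ω t / t ^ 2 * b n, fun n => mul_nonneg hK (hb0 n),
          hscale t ht s ⟨hts.le, hs.2⟩, hbs _⟩
      obtain ⟨y, hy⟩ := cauchySeq_tendsto_of_complete this
      exact ⟨y, fun _ => hy⟩
    · exact ⟨0, fun h => absurd h hs⟩
  choose d hd using hd
  have hfu : TendstoUniformlyOn (fun n => (u n).toFun) f atTop (Icc 0 T₀) := by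
    rw [Metric.tendstoUniformlyOn_iff]
    intro ε hε
    filter_upwards [hblim.eventually_lt_const hε] with n hn t ht
    refine lt_of_le_of_lt ?_ hn
    rw [dist_comm]
    exact le_of_tendsto (tendsto_const_nhds.dist (hf t ht)) (eventually_atTop.2 ⟨n, fun m hm =>
      (abs_sub_le_dist _ _ ht).trans (hb n m n le_rfl hm)⟩)
  have hdu : ∀ t ∈ Ioo 0 T₀,
      TendstoUniformlyOn (fun n => (u n).deriv') d atTop (Icc t T₀) := by
    intro t ht
    rw [Metric.tendstoUniformlyOn_iff]
    intro ε hε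
    filter_upwards [(hbs (ω t / t ^ 2)).eventually_lt_const hε] with n hn s hs
    refine lt_of_le_of_lt ?_ hn
    rw [dist_comm]
    exact le_of_tendsto (tendsto_const_nhds.dist (hd s ⟨ht.1.trans_le hs.1, hs.2⟩))
      (eventually_atTop.2 ⟨n, fun m hm => hscale t ht s hs n m n le_rfl hm⟩)
  have hfc : ContinuousOn f (Icc 0 T₀) :=
    hfu.continuousOn (Frequently.of_forall fun n => (u n).continuousOn)
  have hdc : ContinuousOn d (Ioc 0 T₀) := by
    intro s hs
    obtain ⟨t, ht, hts⟩ := hleft s hs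
    have h1 : ContinuousOn d (Icc t T₀) := (hdu t ht).continuousOn
      (Frequently.of_forall fun n => (u n).continuousOn_deriv'.mono
        fun r hr => ⟨ht.1.trans_le hr.1, hr.2⟩)
    refine (h1 s ⟨hts.le, hs.2⟩).mono_of_mem_nhdsWithin ?_
    filter_upwards [inter_mem_nhdsWithin (Ioc 0 T₀) (Ioi_mem_nhds hts)] with r hr
    exact ⟨(mem_Ioi.1 hr.2).le, hr.1.2⟩
  have hfd : ∀ s ∈ Ioo 0 T₀, HasDerivAt f (d s) s := by
    intro s hs
    obtain ⟨t, ht, hts⟩ := hleft s (Ioo_subset_Ioc_self hs)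
    exact hasDerivAt_of_tendstoUniformlyOn (isOpen_Ioo (a := t) (b := T₀))
      ((hdu t ht).mono Ioo_subset_Icc_self)
      (Eventually.of_forall fun n r hr => (u n).hasDerivAt ⟨ht.1.trans hr.1, hr.2⟩)
      (fun r hr => hf r ⟨(ht.1.trans hr.1).le, hr.2.le⟩) ⟨hts, hs.2⟩
  have hfd' : ∀ s ∈ Ioc 0 T₀, HasDerivWithinAt f (d s) (Ioc 0 T₀) s := by
    intro s hs
    -- Differentiation of the limit is available on open intervals only; at T₀ the one-sided
    -- derivative is recovered as the limit of the derivatives from the left.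
    rcases hs.2.eq_or_lt with rfl | h
    · refine (hasDerivWithinAt_Iic_of_tendsto_deriv (s := Ioo 0 s)
        (fun r hr => (hfd r hr).differentiableAt.differentiableWithinAt)
        ((hfc s (right_mem_Icc.2 hT.le)).mono Ioo_subset_Icc_self) (Ioo_mem_nhdsLT hT) ?_).mono
        Ioc_subset_Iic_self
      refine Tendsto.congr' ?_ ((hdc s hs).mono_left (nhdsWithin_le_of_mem
        (mem_of_superset (Ioo_mem_nhdsLT hT) Ioo_subset_Ioc_self)))
      filter_upwards [Ioo_mem_nhdsLT hT] with r hr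
      exact (hfd r hr).deriv.symm
    · exact (hfd s ⟨hs.1, h⟩).hasDerivWithinAt
  obtain ⟨c, hc, hc'⟩ := exists_of_hasDerivWithinAt (hT := hT) (μ₁ := μ₁) (μ₂ := μ₂) (ω := ω)
    hfc hfd' hdc
    (fun t ht => ⟨ge_of_tendsto' (hf t (Ioo_subset_Icc_self ht)) fun n => ((u n).hyperbolic t ht).1,
      le_of_tendsto' (hf t (Ioo_subset_Icc_self ht)) fun n => ((u n).hyperbolic t ht).2⟩)
    (fun t ht => le_of_tendsto' (hd t ht).abs fun n => (u n).deriv_le t ht)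
  refine ⟨c, tendsto_iff_dist_tendsto_zero.2 (squeeze_zero (fun _ => dist_nonneg)
    (g := fun n => b n + b n) (fun n => ?_) (by simpa using hblim.add hblim))⟩
  refine dist_le (fun t ht => ?_) (fun t ht => ?_)
  · rw [hc (Ioo_subset_Icc_self ht)]
    exact le_of_tendsto (tendsto_const_nhds.sub (hf t (Ioo_subset_Icc_self ht))).abs
      (eventually_atTop.2 ⟨n, fun m hm =>
        (abs_sub_le_dist _ _ (Ioo_subset_Icc_self ht)).trans (hb n m n le_rfl hm)⟩)
  · rw [hc' (Ioo_subset_Ioc_self ht)]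
    exact le_of_tendsto
      ((tendsto_const_nhds.sub (hd t (Ioo_subset_Ioc_self ht))).abs.const_mul _)
      (eventually_atTop.2 ⟨n, fun m hm =>
        (mul_abs_sub_deriv_le_dist _ _ ht).trans (hb n m n le_rfl hm)⟩)

end PS1

/-! ### A C¹ change of time that stops near the origin -/

theorem hasDerivAt_max_zero_sq (x : ℝ) : HasDerivAt (fun x => max x 0 ^ 2) (2 * max x 0) x := by
  rcases lt_trichotomy x 0 with hx | rfl | hx
  · rw [max_eq_right hx.le, mul_zero]
    refine (hasDerivAt_const x (0 : ℝ)).congr_of_eventuallyEq ?_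
    filter_upwards [Iio_mem_nhds hx] with y hy
    simp [max_eq_right (mem_Iio.1 hy).le]
  · rw [max_self, mul_zero, hasDerivAt_iff_isLittleO]
    have h : (fun y : ℝ => y ^ 2) =o[𝓝 0] fun y => y ^ 1 :=
      Asymptotics.isLittleO_pow_pow one_lt_two
    refine Asymptotics.IsBigO.trans_isLittleO (Asymptotics.IsBigO.of_bound 1 ?_)
      (by simpa using h)
    refine Eventually.of_forall fun y => ?_
    simp only [max_self, ne_eq, OfNat.ofNat_ne_zero, not_false_eq_true, zero_pow, sub_zero,
      smul_zero, norm_pow, one_mul]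
    refine pow_le_pow_left₀ (norm_nonneg _) ?_ 2
    rw [Real.norm_eq_abs, abs_of_nonneg (le_max_right _ _)]
    exact max_le (le_abs_self y) (abs_nonneg y)
  · rw [max_eq_left hx.le]
    refine ((hasDerivAt_id x).pow 2).congr_of_eventuallyEq ?_ |>.congr_deriv (by simp)
    filter_upwards [Ioi_mem_nhds hx] with y hy
    simp [max_eq_left (mem_Ioi.1 hy).le]

/-- A function of class `C¹` that is constant for `t ≤ τ` and equal to `t` for `t ≥ 3 τ`. -/
noncomputable def stall (τ t : ℝ) : ℝ := 2 * τ + (max (t - τ) 0 ^ 2 - max (t - 3 * τ) 0 ^ 2) / (4 * τ)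

/-- The derivative of `stall`. -/
noncomputable def stall' (τ t : ℝ) : ℝ := (max (t - τ) 0 - max (t - 3 * τ) 0) / (2 * τ)

section stall

variable {τ t : ℝ}

theorem hasDerivAt_stall (hτ : 0 < τ) : HasDerivAt (stall τ) (stall' τ t) t := by
  have h1 : HasDerivAt (fun t => max (t - τ) 0 ^ 2) (2 * max (t - τ) 0) t :=
    (hasDerivAt_max_zero_sq (t - τ)).comp_sub_const t τ
  have h2 : HasDerivAt (fun t => max (t - 3 * τ) 0 ^ 2) (2 * max (t - 3 * τ) 0) t :=
    (hasDerivAt_max_zero_sq (t - 3 * τ)).comp_sub_const t (3 * τ)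
  refine (((h1.sub h2).div_const (4 * τ)).const_add (2 * τ)).congr_deriv ?_
  rw [stall']
  field_simp
  ring

theorem continuous_stall' : Continuous (stall' τ) := by
  unfold stall'
  fun_prop

theorem stall_of_le (hτ : 0 < τ) (ht : t ≤ τ) : stall τ t = 2 * τ := by
  rw [stall, max_eq_right (by linarith), max_eq_right (by linarith)]
  simp

theorem stall_of_ge (hτ : 0 < τ) (ht : 3 * τ ≤ t) : stall τ t = t ∧ stall' τ t = 1 := by
  rw [stall, stall', max_eq_left (by linarith), max_eq_left (by linarith)]
  constructor
  · field_simp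
    ring
  · field_simp
    ring

theorem stall'_mem (hτ : 0 < τ) : stall' τ t ∈ Icc 0 1 := by
  rw [stall']
  refine ⟨div_nonneg ?_ (by linarith), (div_le_one (by linarith)).2 ?_⟩
  · exact sub_nonneg.2 (max_le_max_right 0 (by linarith))
  · have : max (t - τ) 0 ≤ max (t - 3 * τ) 0 + 2 * τ :=
      max_le (by linarith [le_max_left (t - 3 * τ) 0]) (by linarith [le_max_right (t - 3 * τ) 0])
    linarith

/-- Since ω(t)/t is nonincreasing, t ≤ `stall τ t` together with a slope of at most 1 lets
composition preserve the derivative constraint. The bound by t + 2τ keeps the composition uniformly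
close to the original. -/
theorem stall_bounds (hτ : 0 < τ) (ht : 0 ≤ t) (ht3 : t ≤ 3 * τ) :
    2 * τ ≤ stall τ t ∧ t ≤ stall τ t ∧ stall τ t ≤ 3 * τ ∧ stall τ t ≤ t + 2 * τ := by
  rcases le_total t τ with h | h
  · rw [stall_of_le hτ h]
    exact ⟨by linarith, by linarith, by linarith, by linarith⟩
  · have e : stall τ t = 2 * τ + (t - τ) ^ 2 / (4 * τ) := by
      rw [stall, max_eq_left (by linarith), max_eq_right (by linarith)]
      simp
    have e2 : stall τ t - t = (t - 3 * τ) ^ 2 / (4 * τ) := by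
      rw [e]
      field_simp
      ring
    have h1 : 0 ≤ (t - τ) ^ 2 / (4 * τ) := by positivity
    have h2 : 0 ≤ (t - 3 * τ) ^ 2 / (4 * τ) := by positivity
    have h3 : (t - τ) ^ 2 / (4 * τ) ≤ τ := by
      rw [div_le_iff₀ (by linarith)]
      nlinarith
    exact ⟨by linarith, by linarith, by linarith, by linarith⟩

end stall

/-! ### Density of the speeds that are constant near the origin -/

namespace PS1

variable {T₀ : ℝ} {hT : 0 < T₀} {μ₁ μ₂ : ℝ} {ω : ℝ → ℝ}

/-- The propagation speeds that are constant near the origin, and take there a value in the open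
interval `(μ₁, μ₂)`, are dense. -/
theorem exists_dist_lt_const_near_zero (hμ : μ₁ < μ₂) (hω_pos : ∀ t ∈ Ioc 0 T₀, 0 < ω t)
    (hω_anti : AntitoneOn ω (Ioc 0 T₀)) (c₀ : PS1 hT μ₁ μ₂ ω) {ε : ℝ} (hε : 0 < ε) :
    ∃ c : PS1 hT μ₁ μ₂ ω, dist c c₀ < ε ∧
      ∃ τ ∈ Ioo 0 T₀, ∃ γ ∈ Ioo μ₁ μ₂, ∀ t ∈ Icc 0 τ, c.toFun t = γ := by
  -- `θ` contracts the values towards the midpoint of [μ₁, μ₂], making them interior. The two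
  -- smallness conditions bound the cost of the contraction in the values and in the weighted
  -- derivative.
  obtain ⟨θ, hθ0, hθ1, hθμ, hθT⟩ : ∃ θ : ℝ, 0 < θ ∧ θ < 1 ∧ θ * (μ₂ - μ₁) ≤ ε / 8 ∧
      θ * T₀ ≤ ε / 8 := by
    have h0 : 0 < μ₂ - μ₁ := sub_pos.2 hμ
    refine ⟨min (1 / 2) (min (ε / 8 / (μ₂ - μ₁)) (ε / 8 / T₀)), by positivity,
      (min_le_left _ _).trans_lt (by norm_num), ?_, ?_⟩
    · rw [← le_div_iff₀ h0]
      exact (min_le_right _ _).trans (min_le_left _ _)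
    · rw [← le_div_iff₀ hT]
      exact (min_le_right _ _).trans (min_le_right _ _)
  have huc := isCompact_Icc.uniformContinuousOn_of_continuous c₀.continuousOn
  obtain ⟨δ, hδ, hcδ⟩ := Metric.uniformContinuousOn_iff.1 huc (ε / 8) (by positivity)
  -- For t ≤ 3τ both derivatives are at most ω(t)/t, so their weighted difference is at most 2t ≤
  -- 6τ. The condition `2 * τ < δ` makes the shift of time harmless by uniform continuity.
  obtain ⟨τ, hτ, hτT, hτδ, hτε⟩ : ∃ τ : ℝ, 0 < τ ∧ 3 * τ < T₀ ∧ 2 * τ < δ ∧ 6 * τ ≤ ε / 8 := by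
    refine ⟨min (T₀ / 4) (min (δ / 4) (ε / 48)), by positivity, ?_, ?_, ?_⟩
    · linarith [min_le_left (T₀ / 4) (min (δ / 4) (ε / 48))]
    · linarith [(min_le_right (T₀ / 4) (min (δ / 4) (ε / 48))).trans (min_le_left _ _)]
    · linarith [(min_le_right (T₀ / 4) (min (δ / 4) (ε / 48))).trans (min_le_right _ _)]
  have hg : ∀ t ∈ Icc 0 T₀, 2 * τ ≤ stall τ t ∧ t ≤ stall τ t ∧ stall τ t ≤ T₀ ∧
      |stall τ t - t| ≤ 2 * τ := by
    intro t ht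
    rcases le_total t (3 * τ) with h | h
    · obtain ⟨h1, h2, h3, h4⟩ := stall_bounds hτ ht.1 h
      exact ⟨h1, h2, by linarith, abs_le.2 ⟨by linarith, by linarith⟩⟩
    · rw [(stall_of_ge hτ h).1]
      exact ⟨by linarith, le_rfl, ht.2, by simpa using hτ.le⟩
  have hgI : ∀ t ∈ Icc 0 T₀, stall τ t ∈ Ioc 0 T₀ := fun t ht =>
    ⟨by linarith [(hg t ht).1], (hg t ht).2.2.1⟩
  have hgc : Continuous (stall τ) :=
    continuous_iff_continuousAt.2 fun t => (hasDerivAt_stall hτ).continuousAt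
  set m := (μ₁ + μ₂) / 2 with hm
  have hval : ∀ y ∈ Icc μ₁ μ₂, (1 - θ) * y + θ * m ∈ Ioo μ₁ μ₂ := by
    intro y hy
    have h1 : 0 ≤ (1 - θ) * (y - μ₁) := mul_nonneg (by linarith) (by linarith [hy.1])
    have h2 : 0 ≤ (1 - θ) * (μ₂ - y) := mul_nonneg (by linarith) (by linarith [hy.2])
    have h3 : 0 < θ * (μ₂ - μ₁) := mul_pos hθ0 (by linarith)
    constructor <;> rw [hm] <;> linarith
  have hdle : ∀ t ∈ Ioc 0 T₀, |(1 - θ) * (c₀.deriv' (stall τ t) * stall' τ t)| ≤ ω t / t := by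
    intro t ht
    have htI := Ioc_subset_Icc_self ht
    have h1 := c₀.deriv_le _ (hgI t htI)
    have hs := stall'_mem (t := t) hτ
    have h2 : ω (stall τ t) / stall τ t ≤ ω t / t :=
      div_le_div₀ (hω_pos t ht).le (hω_anti ht (hgI t htI) (hg t htI).2.1) ht.1 (hg t htI).2.1
    rw [abs_mul, abs_mul, abs_of_pos (by linarith : 0 < 1 - θ), abs_of_nonneg hs.1]
    have h3 : |c₀.deriv' (stall τ t)| * stall' τ t ≤ |c₀.deriv' (stall τ t)| :=
      mul_le_of_le_one_right (abs_nonneg _) hs.2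
    have h4 : (1 - θ) * (|c₀.deriv' (stall τ t)| * stall' τ t) ≤
        |c₀.deriv' (stall τ t)| * stall' τ t :=
      mul_le_of_le_one_left (mul_nonneg (abs_nonneg _) hs.1) (by linarith)
    exact h4.trans (h3.trans (h1.trans h2))
  obtain ⟨c, hc, hc'⟩ := exists_of_hasDerivWithinAt (hT := hT) (μ₁ := μ₁) (μ₂ := μ₂) (ω := ω)
    (f := fun t => (1 - θ) * c₀.toFun (stall τ t) + θ * m)
    (f' := fun t => (1 - θ) * (c₀.deriv' (stall τ t) * stall' τ t))
    (((c₀.continuousOn.comp hgc.continuousOn fun t ht =>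
      Ioc_subset_Icc_self (hgI t ht)).const_mul _).add continuousOn_const)
    (fun t ht => by
      have h1 := (c₀.hasDerivWithinAt (hgI t (Ioc_subset_Icc_self ht))).comp t
        (hasDerivAt_stall hτ).hasDerivWithinAt fun s hs => hgI s (Ioc_subset_Icc_self hs)
      exact (h1.const_mul (1 - θ)).add_const _)
    (((c₀.continuousOn_deriv'.comp hgc.continuousOn fun t ht =>
      hgI t (Ioc_subset_Icc_self ht)).mul continuous_stall'.continuousOn).const_mul _)
    (fun t ht => by
      have := hval _ (c₀.mem_Icc (Ioc_subset_Icc_self (hgI t (Ioo_subset_Icc_self ht))))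
      exact ⟨this.1.le, this.2.le⟩)
    hdle
  refine ⟨c, ?_, τ, ⟨hτ, by linarith⟩, (1 - θ) * c₀.toFun (2 * τ) + θ * m,
    hval _ (c₀.mem_Icc ⟨by linarith, by linarith⟩), fun t ht => ?_⟩
  · refine (dist_le (a := ε / 4) (b := ε / 8) ?_ ?_).trans_lt (by linarith)
    · intro t ht
      have htI := Ioo_subset_Icc_self ht
      rw [hc htI]
      have h1 := hcδ _ (Ioc_subset_Icc_self (hgI t htI)) t htI ((hg t htI).2.2.2.trans_lt hτδ)
      rw [Real.dist_eq] at h1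
      have hy := c₀.mem_Icc (Ioc_subset_Icc_self (hgI t htI))
      have h2 : |θ * (m - c₀.toFun (stall τ t))| ≤ ε / 8 := by
        rw [abs_mul, abs_of_pos hθ0]
        refine (mul_le_mul_of_nonneg_left ?_ hθ0.le).trans hθμ
        exact abs_le.2 ⟨by rw [hm]; linarith [hy.2], by rw [hm]; linarith [hy.1]⟩
      have e : (1 - θ) * c₀.toFun (stall τ t) + θ * m - c₀.toFun t =
        (c₀.toFun (stall τ t) - c₀.toFun t) + θ * (m - c₀.toFun (stall τ t)) := by ring
      simp only [e]
      exact (abs_add_le _ _).trans (by linarith)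
    · intro t ht
      have htI := Ioo_subset_Ioc_self ht
      have hωt := hω_pos t htI
      have ht0 := ht.1
      rw [hc' htI]
      have h1 : |c₀.deriv' t| ≤ ω t / t := c₀.deriv_le t htI
      rcases le_total t (3 * τ) with h | h
      · have h2 : |(1 - θ) * (c₀.deriv' (stall τ t) * stall' τ t) - c₀.deriv' t| ≤
            2 * (ω t / t) := (abs_sub _ _).trans (by linarith [hdle t htI])
        refine (mul_le_mul_of_nonneg_left h2 (by positivity)).trans ?_
        have : t ^ 2 / ω t * (2 * (ω t / t)) = 2 * t := by field_simp
        linarith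
      · simp only [(stall_of_ge hτ h).1, (stall_of_ge hτ h).2]
        have e : (1 - θ) * (c₀.deriv' t * 1) - c₀.deriv' t = -(θ * c₀.deriv' t) := by ring
        rw [e, abs_neg, abs_mul, abs_of_pos hθ0]
        refine (mul_le_mul_of_nonneg_left (mul_le_mul_of_nonneg_left h1 hθ0.le)
          (by positivity)).trans ?_
        have : t ^ 2 / ω t * (θ * (ω t / t)) = θ * t := by field_simp
        rw [this]
        exact (mul_le_mul_of_nonneg_left ht.2.le hθ0.le).trans hθT
  · rw [hc ⟨ht.1, by linarith [ht.2]⟩]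
    simp only [stall_of_le hτ ht.2]

end PS1

/-! ### Amplification of a single mode by a resonant perturbation -/

namespace PS1

variable {T₀ : ℝ} {hT : 0 < T₀} {μ₁ μ₂ : ℝ} {ω : ℝ → ℝ}

/-- Superposition of a propagation speed that is constant near the origin and of a rescaled
resonant perturbation. -/
theorem exists_add_resonance (hω_pos : ∀ t ∈ Ioc 0 T₀, 0 < ω t)
    (hω_anti : AntitoneOn ω (Ioc 0 T₀)) (c₀ : PS1 hT μ₁ μ₂ ω)
    {τ γ : ℝ} (hτ : τ ∈ Ioo 0 T₀) (hγ0 : 0 < γ) (hc₀ : ∀ t ∈ Icc 0 τ, c₀.toFun t = γ)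
    {δ : ℝ} (hδ : 0 ≤ δ) (hγδ : μ₁ + δ ≤ γ ∧ γ + δ ≤ μ₂) {σ : ℝ} (hσ : 0 < σ) (hστ : σ < τ)
    {G : ℝ} (hG : 46 * (γ * G) ≤ ω σ) {ν a b : ℝ} (hν : 0 < ν) (ha : 0 < a) (hb : b ≤ ν * σ)
    (haG : γ * (8 * G) ≤ δ * a)
    {q q' : ℝ → ℝ} (hq : ∀ x, HasDerivAt q (q' x) x) (hqc : Continuous q')
    (hq0 : ∀ x, x ∉ Icc a b → q x = 0 ∧ q' x = 0)
    (hqb : ∀ x ∈ Icc a b, |q x| * x ≤ 8 * G ∧ |q' x| * x ≤ 46 * G) :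
    ∃ c : PS1 hT μ₁ μ₂ ω, dist c c₀ ≤ δ + σ ∧
      ∀ t ∈ Icc 0 T₀, c.toFun t = c₀.toFun t + γ * q (ν * t) := by
  -- The perturbation lives in (0, σ], inside the region where `c₀` is the constant γ.
  have hin : ∀ t, ν * t ∈ Icc a b → 0 < t ∧ t ≤ σ := by
    intro t ht
    exact ⟨pos_of_mul_pos_right (ha.trans_le ht.1) hν.le,
      le_of_mul_le_mul_left (ht.2.trans hb) hν⟩
  have hδ0 : ∀ t, ν * t ∈ Icc a b → |γ * q (ν * t)| ≤ δ := by
    intro t ht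
    have h1 := (hqb _ ht).1
    rw [abs_mul, abs_of_pos hγ0]
    have h2 : |q (ν * t)| * a ≤ 8 * G :=
      (mul_le_mul_of_nonneg_left ht.1 (abs_nonneg _)).trans h1
    have h3 : γ * |q (ν * t)| * a ≤ δ * a := by
      rw [mul_assoc]
      exact (mul_le_mul_of_nonneg_left h2 hγ0.le).trans haG
    exact le_of_mul_le_mul_right h3 ha
  -- The bound on |q'(x)| x is scale invariant: with x = νt it yields a slope of at most 46γG/t
  -- whatever ν is, and 46γG ≤ ω(σ) ≤ ω(t).
  have hωq : ∀ t ∈ Ioc 0 T₀, ν * t ∈ Icc a b → |γ * (q' (ν * t) * ν)| ≤ ω t / t := by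
    intro t htT ht
    obtain ⟨ht0, htσ⟩ := hin t ht
    have h1 := (hqb _ ht).2
    rw [abs_mul, abs_mul, abs_of_pos hγ0, abs_of_pos hν, le_div_iff₀ ht0]
    have h2 : ω σ ≤ ω t := hω_anti htT ⟨hσ, by linarith [hτ.2]⟩ htσ
    have h3 := mul_le_mul_of_nonneg_left h1 hγ0.le
    calc γ * (|q' (ν * t)| * ν) * t = γ * (|q' (ν * t)| * (ν * t)) := by ring
      _ ≤ γ * (46 * G) := h3
      _ ≤ ω t := by linarith
  have hc₀' : ∀ t, ν * t ∈ Icc a b → c₀.deriv' t = 0 := by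
    intro t ht
    obtain ⟨ht0, htσ⟩ := hin t ht
    have h1 : HasDerivAt c₀.toFun 0 t := by
      refine (hasDerivAt_const t γ).congr_of_eventuallyEq ?_
      filter_upwards [Icc_mem_nhds ht0 (htσ.trans_lt hστ)] with s hs using hc₀ s hs
    exact (c₀.hasDerivAt ⟨ht0, by linarith [hτ.2]⟩).unique h1
  have hqν : ∀ t, HasDerivAt (fun t => q (ν * t)) (q' (ν * t) * ν) t := by
    intro t
    exact ((hq (ν * t)).comp t ((hasDerivAt_id t).const_mul ν)).congr_deriv (by rw [mul_one])
  have hqcont : Continuous q := continuous_iff_continuousAt.2 fun x => (hq x).continuousAt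
  obtain ⟨c, hc, hc'⟩ := exists_of_hasDerivWithinAt (hT := hT) (μ₁ := μ₁) (μ₂ := μ₂) (ω := ω)
    (f := fun t => c₀.toFun t + γ * q (ν * t))
    (f' := fun t => c₀.deriv' t + γ * (q' (ν * t) * ν))
    (c₀.continuousOn.add (by fun_prop))
    (fun t ht => (c₀.hasDerivWithinAt ht).add ((hqν t).const_mul γ).hasDerivWithinAt)
    (c₀.continuousOn_deriv'.add (by fun_prop))
    (fun t ht => by
      by_cases h : ν * t ∈ Icc a b
      · have h1 := abs_le.1 (hδ0 t h)
        rw [hc₀ t ⟨ht.1.le, (hin t h).2.trans hστ.le⟩]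
        constructor <;> linarith [hγδ.1, hγδ.2]
      · rw [(hq0 _ h).1, mul_zero, add_zero]
        exact c₀.hyperbolic t ht)
    (fun t ht => by
      by_cases h : ν * t ∈ Icc a b
      · rw [hc₀' t h, zero_add]
        exact hωq t ht h
      · rw [(hq0 _ h).2, zero_mul, mul_zero, add_zero]
        exact c₀.deriv_le t ht)
  refine ⟨c, dist_le (fun t ht => ?_) (fun t ht => ?_), hc⟩
  · rw [hc (Ioo_subset_Icc_self ht), add_sub_cancel_left]
    by_cases h : ν * t ∈ Icc a b
    · exact hδ0 t h
    · rw [(hq0 _ h).1, mul_zero, abs_zero]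
      exact hδ
  · have ht' := Ioo_subset_Ioc_self ht
    have hωt := hω_pos t ht'
    have ht0 := ht.1
    rw [hc' ht', add_sub_cancel_left]
    by_cases h : ν * t ∈ Icc a b
    · refine (mul_le_mul_of_nonneg_left (hωq t ht' h) (by positivity)).trans ?_
      have : t ^ 2 / ω t * (ω t / t) = t := by field_simp
      rw [this]
      exact (hin t h).2
    · rw [(hq0 _ h).2, zero_mul, mul_zero, abs_zero, mul_zero]
      exact hσ.le

/-- Growth after the resonance: if the solution of a mode vanishes at `s` with slope at least
`S`, then it stays large. -/
theorem energy_lower_bound (hμ₁ : 0 < μ₁) (hω_pos : ∀ t ∈ Ioc 0 T₀, 0 < ω t)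
    (hω_anti : AntitoneOn ω (Ioc 0 T₀)) (c : PS1 hT μ₁ μ₂ ω)
    {l : ℝ} (hl : 0 ≤ l) {w w₁ : ℝ → ℝ} (hw : IsModeSolution T₀ (fun t => c.toFun t * l) w w₁)
    {r s : ℝ} (hr : r ∈ Ioc 0 T₀) (hrs : r ≤ s) (hws : w s = 0) :
    ∀ t ∈ Icc s T₀, Real.exp (-(ω r / r / μ₁ * T₀)) * w₁ s ^ 2 ≤
      (1 + μ₂ * l) * (w t ^ 2 + w₁ t ^ 2) := by
  intro t ht
  have hs0 : 0 < s := hr.1.trans_le hrs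
  have hr0 := hr.1
  have hωr := hω_pos r hr
  have hL : 0 ≤ ω r / r / μ₁ := by positivity
  have hsub : Icc s T₀ ⊆ Icc 0 T₀ := Icc_subset_Icc_left hs0.le
  -- On [r, T₀] the ratio |c'|/c is at most ω(r)/(r μ₁). The factor `l` cancels from it, so the loss
  -- of energy does not depend on the frequency.
  have h := hw.exp_mul_le_energy (k₁ := fun t => c.deriv' t * l) hs0.le hL
    ((c.continuousOn.mono hsub).mul continuousOn_const)
    (fun x hx => (c.hasDerivAt ⟨hs0.trans hx.1, hx.2⟩).mul_const l)
    (fun x hx => by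
      have hx0 : 0 < x := hs0.trans hx.1
      have hxI : x ∈ Ioc 0 T₀ := ⟨hx0, hx.2.le⟩
      have hrx : r ≤ x := hrs.trans hx.1.le
      have h1 : |c.deriv' x| ≤ ω x / x := c.deriv_le x hxI
      have h2 : ω x / x ≤ ω r / r := div_le_div₀ hωr.le (hω_anti hr hxI hrx) hr0 hrx
      have h3 : ω r / r ≤ ω r / r / μ₁ * c.toFun x := by
        have := mul_le_mul_of_nonneg_left (c.mem_Icc (Ioc_subset_Icc_self hxI)).1 hL
        rwa [div_mul_cancel₀ _ hμ₁.ne'] at this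
      rw [abs_mul, abs_of_nonneg hl, ← mul_assoc]
      exact mul_le_mul_of_nonneg_right (h1.trans (h2.trans h3)) hl) t ht
  rw [hws] at h
  have hct := c.mem_Icc (hsub ht)
  have hμ₂ : 0 ≤ μ₂ := hμ₁.le.trans (hct.1.trans hct.2)
  have hexp : Real.exp (-(ω r / r / μ₁ * T₀)) ≤ Real.exp (-(ω r / r / μ₁ * (t - s))) := by
    refine Real.exp_le_exp.2 (neg_le_neg (mul_le_mul_of_nonneg_left ?_ hL))
    linarith [ht.2]
  have h1 : Real.exp (-(ω r / r / μ₁ * T₀)) * w₁ s ^ 2 ≤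
      Real.exp (-(ω r / r / μ₁ * (t - s))) * w₁ s ^ 2 :=
    mul_le_mul_of_nonneg_right hexp (sq_nonneg _)
  have h2 : c.toFun t * l ≤ μ₂ * l := mul_le_mul_of_nonneg_right hct.2 hl
  have h3 : c.toFun t * l * w t ^ 2 ≤ μ₂ * l * w t ^ 2 :=
    mul_le_mul_of_nonneg_right h2 (sq_nonneg _)
  have h4 : 0 ≤ μ₂ * l * w₁ t ^ 2 := by positivity
  simp only [ne_eq, OfNat.ofNat_ne_zero, not_false_eq_true, zero_pow, mul_zero, add_zero] at h
  nlinarith [sq_nonneg (w t)]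

/-- Every propagation speed that is constant near the origin can be perturbed so that the solution
of a given mode of large frequency is amplified by a given power of the frequency. -/
theorem exists_dist_lt_amplified (hμ₁ : 0 < μ₁) (hω_pos : ∀ t ∈ Ioc 0 T₀, 0 < ω t)
    (hω_anti : AntitoneOn ω (Ioc 0 T₀)) (hω_lim : Tendsto ω (𝓝[>] 0) atTop)
    (c₀ : PS1 hT μ₁ μ₂ ω) {τ γ : ℝ} (hτ : τ ∈ Ioo 0 T₀) (hγ : γ ∈ Ioo μ₁ μ₂)
    (hc₀ : ∀ t ∈ Icc 0 τ, c₀.toFun t = γ) {ε : ℝ} (hε : 0 < ε) {T₁ : ℝ} (hT₁ : 0 < T₁)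
    (N : ℕ) :
    ∃ l₀ : ℝ, ∀ l, l₀ ≤ l → ∃ c : PS1 hT μ₁ μ₂ ω, dist c c₀ < ε ∧
      ∃ w w₁ : ℝ → ℝ, IsModeSolution T₀ (fun t => c.toFun t * l) w w₁ ∧
        ∀ t ∈ Icc T₁ T₀, l ^ N < w t ^ 2 + w₁ t ^ 2 := by
  have hγ0 : 0 < γ := hμ₁.trans hγ.1
  have hμ₂ : 0 < μ₂ := hγ0.trans hγ.2
  -- With `G = 4 * p` the slope grows by (n/m)^p, so its square is of order l^p. Of the two powers
  -- beyond `N`, one pays for the factor 1 + μ₂ l between energy and w² + w₁², the other for the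
  -- constants.
  set p : ℕ := N + 2 with hp
  set G : ℝ := 4 * p with hG
  have hp2 : (2 : ℝ) ≤ p := by rw [hp]; push_cast; linarith [(Nat.cast_nonneg N : (0 : ℝ) ≤ N)]
  have hG1 : 1 ≤ G := by linarith
  obtain ⟨δ, hδ, hδε, hγδ⟩ : ∃ δ : ℝ, 0 < δ ∧ δ ≤ ε / 4 ∧ μ₁ + δ ≤ γ ∧ γ + δ ≤ μ₂ := by
    have h1 := sub_pos.2 hγ.1
    have h2 := sub_pos.2 hγ.2
    refine ⟨min (ε / 4) (min (γ - μ₁) (μ₂ - γ)), by positivity, min_le_left _ _, ?_, ?_⟩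
    · linarith [(min_le_right (ε / 4) (min (γ - μ₁) (μ₂ - γ))).trans (min_le_left _ _)]
    · linarith [(min_le_right (ε / 4) (min (γ - μ₁) (μ₂ - γ))).trans (min_le_right _ _)]
  obtain ⟨m, hmG, hmδ⟩ : ∃ m : ℕ, G ≤ m ∧ γ * (8 * G) ≤ δ * m := by
    obtain ⟨m, hm⟩ := exists_nat_ge (max G (γ * (8 * G) / δ))
    refine ⟨m, (le_max_left _ _).trans hm, ?_⟩
    rw [← div_le_iff₀' hδ]
    exact (le_max_right _ _).trans hm
  obtain ⟨σ, hσ0, hστ, hσT, hσε, hσω⟩ : ∃ σ : ℝ, 0 < σ ∧ σ < τ ∧ σ < T₁ ∧ σ < ε / 4 ∧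
      46 * (γ * G) ≤ ω σ := by
    have h := ((hω_lim.eventually_ge_atTop (46 * (γ * G))).and
      (Ioo_mem_nhdsGT (by have := hτ.1; positivity : (0 : ℝ) < min τ (min T₁ (ε / 4))))).exists
    obtain ⟨σ, h1, h2, h3⟩ := h
    exact ⟨σ, h2, h3.trans_le (min_le_left _ _),
      h3.trans_le ((min_le_right _ _).trans (min_le_left _ _)),
      h3.trans_le ((min_le_right _ _).trans (min_le_right _ _)), h1⟩
  have hpi := Real.pi_pos
  have hm1 : (1 : ℝ) ≤ m := hG1.trans hmG
  -- `B` is such that B ν ≤ n/m, because n ≥ νσ/(2π). The resonance ends at a time in [σ/2, σ], so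
  -- `r = σ / 2` makes `C` independent of `l`, which is chosen afterwards.
  set B : ℝ := σ / (2 * Real.pi * m) with hB
  have hB0 : 0 < B := by positivity
  set r : ℝ := σ / 2 with hr
  set C : ℝ := Real.exp (-(ω r / r / μ₁ * T₀)) * (B ^ 2 * γ) ^ p with hC
  have hC0 : 0 < C := by positivity
  refine ⟨max 1 (max ((1 + μ₂) / C + 1) (((m + 2) * Real.pi / σ) ^ 2 / γ)), fun l hl => ?_⟩
  have hl1 : 1 ≤ l := (le_max_left _ _).trans hl
  have hlC : 1 + μ₂ < C * l := by
    have : (1 + μ₂) / C + 1 ≤ l := ((le_max_left _ _).trans (le_max_right _ _)).trans hl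
    rw [← div_lt_iff₀' hC0]
    linarith
  have hlm : ((m + 2) * Real.pi / σ) ^ 2 / γ ≤ l :=
    ((le_max_right _ _).trans (le_max_right _ _)).trans hl
  have hl0 : 0 < l := by linarith
  set ν : ℝ := Real.sqrt (γ * l) with hν
  have hν2 : ν ^ 2 = γ * l := Real.sq_sqrt (by positivity)
  have hν0 : 0 < ν := Real.sqrt_pos.2 (by positivity)
  have hνm : (m + 2) * Real.pi ≤ ν * σ := by
    rw [← div_le_iff₀ hσ0]
    refine Real.le_sqrt_of_sq_le ?_
    rwa [div_le_iff₀' hγ0] at hlm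
  -- The largest n for which the support of the perturbation stays below time σ. As νσ/π ≥ m + 2,
  -- rounding down leaves n > m and loses at most half of the quotient.
  set n : ℕ := ⌊ν * σ / Real.pi⌋₊ with hn
  have hx : (m + 2 : ℝ) ≤ ν * σ / Real.pi := (le_div_iff₀ hpi).2 hνm
  have hn1 : (n : ℝ) ≤ ν * σ / Real.pi := Nat.floor_le (by positivity)
  have hn2 : ν * σ / Real.pi < n + 1 := Nat.lt_floor_add_one _
  have hmn : m < n := by
    have : (m : ℝ) < n := by linarith
    exact_mod_cast this
  have hnσ : n * Real.pi ≤ ν * σ := (le_div_iff₀ hpi).1 hn1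
  have hnr : ν * r ≤ n * Real.pi := by
    have : ν * σ / Real.pi / 2 ≤ n := by linarith
    rw [div_right_comm, div_le_iff₀ hpi] at this
    rw [hr]
    linarith
  have hBn : B * ν ≤ n / m := by
    rw [le_div_iff₀ (by linarith)]
    have : B * ν * m = ν * r / Real.pi := by
      rw [hB, hr]
      field_simp
    rw [this]
    exact (div_le_iff₀ hpi).2 hnr
  obtain ⟨q, q', W, W', hq, hqc, hq0, hqb, hW, hW', hW0, hW0', hWn, hWn'⟩ :=
    exists_resonance hG1 hmG hmn
  have haG : γ * (8 * G) ≤ δ * (m * Real.pi) := by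
    refine hmδ.trans (mul_le_mul_of_nonneg_left ?_ hδ.le)
    nlinarith [Real.pi_gt_three]
  obtain ⟨c, hcd, hc⟩ := exists_add_resonance hω_pos hω_anti c₀ hτ hγ0 hc₀ hδ.le hγδ hσ0 hστ hσω
    hν0 (by positivity : (0 : ℝ) < m * Real.pi) hnσ haG hq hqc hq0 hqb
  refine ⟨c, hcd.trans_lt (by linarith), ?_⟩
  have hk : ContinuousOn (fun t => c.toFun t * l) (Icc 0 T₀) :=
    c.continuousOn.mul continuousOn_const
  obtain ⟨w, w₁, hw⟩ := exists_isModeSolution hT.le hk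
  refine ⟨w, w₁, hw, ?_⟩
  set s : ℝ := n * Real.pi / ν with hs
  have hνs : ν * s = n * Real.pi := by rw [hs]; field_simp
  have hrs : r ≤ s := by rw [hs, le_div_iff₀ hν0]; linarith
  have hsσ : s ≤ σ := by rw [hs, div_le_iff₀ hν0]; linarith
  have hsT : s ≤ T₀ := by linarith [hτ.2]
  have hr0 : 0 < r := by positivity
  -- On [0, s] the coefficient is c l = ν²(1 + q(νt)), so the rescaled resonant solution is the
  -- mode; uniqueness then transfers its values at s to `w` and `w₁`.
  have hexpl : IsModeSolution s (fun t => c.toFun t * l) (fun t => W (ν * t) / ν)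
      (fun t => W' (ν * t)) := by
    have hcomp : ∀ t, HasDerivAt (fun t => ν * t) ν t := fun t => by
      simpa using (hasDerivAt_id t).const_mul ν
    refine ⟨fun t _ => ?_, fun t ht => ?_, by simp [hW0], by simp [hW0']⟩
    · refine ((((hW (ν * t)).comp t (hcomp t)).div_const ν).congr_deriv ?_).hasDerivWithinAt
      field_simp
    · refine (((hW' (ν * t)).comp t (hcomp t)).congr_deriv ?_).hasDerivWithinAt
      rw [hc t ⟨ht.1, ht.2.trans hsT⟩, hc₀ t ⟨ht.1, by linarith [ht.2]⟩]
      field_simp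
      rw [hν2]
      ring
  have hmem : s ∈ Icc 0 s := right_mem_Icc.2 (by linarith)
  obtain ⟨hE, hE₁⟩ := hexpl.eqOn (hw.mono hsT) (hk.mono (Icc_subset_Icc_right hsT))
  have hws : w s = 0 := by
    rw [hE hmem]
    simp only [hνs, hWn, zero_div]
  have hw₁s : (B ^ 2 * γ) ^ p * l ^ p ≤ w₁ s ^ 2 := by
    have e1 : Real.exp (G / 4 * Real.log (n / m)) = ((n : ℝ) / m) ^ p := by
      have hpos : (0 : ℝ) < n / m := (mul_pos hB0 hν0).trans_le hBn
      rw [hG, mul_div_cancel_left₀ _ (by norm_num : (4 : ℝ) ≠ 0), mul_comm,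
        ← Real.rpow_def_of_pos hpos, Real.rpow_natCast]
    rw [e1] at hWn'
    have h1 : (B * ν) ^ p ≤ |w₁ s| := by
      rw [hE₁ hmem]
      simp only [hνs]
      exact (pow_le_pow_left₀ (by positivity) hBn p).trans hWn'
    calc (B ^ 2 * γ) ^ p * l ^ p = ((B * ν) ^ p) ^ 2 := by
          rw [← mul_pow, ← pow_mul, mul_comm p 2, pow_mul (B * ν), mul_pow B ν, hν2]
          ring
      _ ≤ |w₁ s| ^ 2 := pow_le_pow_left₀ (by positivity) h1 2
      _ = w₁ s ^ 2 := sq_abs _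
  intro t ht
  have hlow := energy_lower_bound hμ₁ hω_pos hω_anti c hl0.le hw ⟨hr0, by linarith⟩ hrs hws t
    ⟨by linarith [ht.1], ht.2⟩
  have h1 : C * l ^ p ≤ (1 + μ₂ * l) * (w t ^ 2 + w₁ t ^ 2) := by
    refine le_trans ?_ hlow
    rw [hC, mul_assoc]
    exact mul_le_mul_of_nonneg_left hw₁s (Real.exp_pos _).le
  have h2 : 1 + μ₂ * l < C * l ^ 2 := by
    calc 1 + μ₂ * l ≤ (1 + μ₂) * l := by linarith
      _ < C * l * l := mul_lt_mul_of_pos_right hlC hl0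
      _ = C * l ^ 2 := by ring
  have h3 : (1 + μ₂ * l) * l ^ N < (1 + μ₂ * l) * (w t ^ 2 + w₁ t ^ 2) := by
    refine lt_of_lt_of_le ?_ h1
    have := mul_lt_mul_of_pos_right h2 (pow_pos hl0 N)
    calc _ < C * l ^ 2 * l ^ N := this
      _ = C * l ^ p := by rw [hp, pow_add]; ring
  exact lt_of_mul_lt_mul_left h3
    (add_nonneg zero_le_one (mul_nonneg hμ₂.le hl0.le))

end PS1

/-! ### The open dense sets of amplifying speeds -/

namespace PS1

variable {T₀ : ℝ} {hT : 0 < T₀} {μ₁ μ₂ : ℝ} {ω : ℝ → ℝ}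

/-- The propagation speeds for which some mode of frequency greater than `K + 2` is amplified by
the power `4 K` of the frequency, uniformly in `[T₀ / (K + 1), T₀]`. -/
def amplifying (hT : 0 < T₀) (μ₁ μ₂ : ℝ) (ω : ℝ → ℝ) (ev : ℕ → ℝ) (K : ℕ) :
    Set (PS1 hT μ₁ μ₂ ω) :=
  {c | ∃ n, (K + 2 : ℝ) < ev n ∧ ∃ w w₁ : ℝ → ℝ,
    IsModeSolution T₀ (fun t => c.toFun t * ev n) w w₁ ∧
      ∀ t ∈ Icc (T₀ / (K + 1)) T₀, ev n ^ (4 * K) < w t ^ 2 + w₁ t ^ 2}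

/-- The mode that witnesses membership is kept fixed. Compactness of the time interval gives the
strict inequality a positive margin, and a change of c by d changes the coefficient of that mode by
at most d times its eigenvalue. -/
theorem isOpen_amplifying (hμ₁ : 0 < μ₁) (ev : ℕ → ℝ) (K : ℕ) :
    IsOpen (amplifying hT μ₁ μ₂ ω ev K) := by
  rw [Metric.isOpen_iff]
  rintro c ⟨n, hn, w, w₁, hw, hlt⟩
  set l := ev n with hl
  have hl0 : 0 < l := by
    have : (0 : ℝ) ≤ K := Nat.cast_nonneg K
    linarith
  have hT₁ : T₀ / (K + 1) ≤ T₀ := div_le_self hT.le (by simp)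
  have hT₁0 : 0 ≤ T₀ / (K + 1) := by positivity
  have hsub : Icc (T₀ / (K + 1)) T₀ ⊆ Icc 0 T₀ := Icc_subset_Icc_left hT₁0
  have hcont : ContinuousOn (fun t => w t ^ 2 + w₁ t ^ 2) (Icc (T₀ / (K + 1)) T₀) :=
    ((hw.continuousOn_fst.pow 2).add (hw.continuousOn_snd.pow 2)).mono hsub
  obtain ⟨t₀, ht₀, hmin⟩ := isCompact_Icc.exists_isMinOn (nonempty_Icc.2 hT₁) hcont
  obtain ⟨B₁, hB₁⟩ := isCompact_Icc.exists_bound_of_continuousOn hw.continuousOn_fst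
  obtain ⟨B₂, hB₂⟩ := isCompact_Icc.exists_bound_of_continuousOn hw.continuousOn_snd
  set B := max B₁ B₂ with hB
  have hBw : ∀ t ∈ Icc 0 T₀, |w t| ≤ B := fun t ht => (hB₁ t ht).trans (le_max_left _ _)
  have hBw₁ : ∀ t ∈ Icc 0 T₀, |w₁ t| ≤ B := fun t ht => (hB₂ t ht).trans (le_max_right _ _)
  have hB0 : 0 ≤ B := (abs_nonneg _).trans (hBw 0 (left_mem_Icc.2 hT.le))
  have hct := c.mem_Icc (left_mem_Icc.2 hT.le)
  have hμ₂ : 0 < μ₂ := hμ₁.trans_le (hct.1.trans hct.2)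
  set M := 1 + μ₂ * l with hM
  have hμl : 0 < μ₂ * l := mul_pos hμ₂ hl0
  have hM1 : 1 ≤ M := by linarith
  set D := B / M * (Real.exp (M * T₀) - 1) with hD
  have hD0 : 0 ≤ D := by
    have : 1 ≤ Real.exp (M * T₀) := Real.one_le_exp (mul_nonneg (by linarith) hT.le)
    exact mul_nonneg (div_nonneg hB0 (by linarith)) (by linarith)
  set η := w t₀ ^ 2 + w₁ t₀ ^ 2 - l ^ (4 * K) with hη
  have hη0 : 0 < η := sub_pos.2 (hlt t₀ ht₀)
  -- If w and w₁ move by at most `ρ ≤ 1`, each square drops by at most `ρ * (2 * B + 1)`, so the two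
  -- together use at most half of the margin `η`.
  set ρ := min 1 (η / (4 * (2 * B + 1))) with hρ
  have hρ0 : 0 < ρ := by positivity
  have hρη : ρ * (4 * (2 * B + 1)) ≤ η := by
    rw [← le_div_iff₀ (by positivity)]
    exact min_le_right _ _
  refine ⟨ρ / (l * (D + 1)), by positivity, fun c' hc' => ?_⟩
  obtain ⟨z, z₁, hz⟩ := exists_isModeSolution hT.le (k := fun t => c'.toFun t * l)
    (c'.continuousOn.mul (continuousOn_const (c := l)))
  refine ⟨n, hn, z, z₁, hz, fun t ht => ?_⟩
  have hd : dist c' c * l * D ≤ ρ := by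
    rw [Metric.mem_ball, lt_div_iff₀ (by positivity)] at hc'
    have : 0 ≤ dist c' c * l := mul_nonneg dist_nonneg hl0.le
    nlinarith
  obtain ⟨h1, h2⟩ := hw.dist_le hz hM1 (mul_nonneg dist_nonneg hl0.le)
    (fun s hs => by
      have := c'.mem_Icc hs
      rw [abs_of_nonneg (mul_nonneg (hμ₁.le.trans this.1) hl0.le)]
      have := mul_le_mul_of_nonneg_right this.2 hl0.le
      linarith)
    (fun s hs => by
      rw [← sub_mul, abs_mul, abs_of_pos hl0]
      exact mul_le_mul_of_nonneg_right (abs_sub_le_dist c' c hs) hl0.le) hBw t (hsub ht)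
  have hsq : ∀ x y : ℝ, |x - y| ≤ ρ → |y| ≤ B → y ^ 2 - ρ * (2 * B + 1) ≤ x ^ 2 := by
    intro x y hxy hy
    have h3 : |(x - y) * (2 * y + (x - y))| ≤ ρ * (2 * B + 1) := by
      rw [abs_mul]
      refine mul_le_mul hxy ((abs_add_le _ _).trans (add_le_add ?_ ?_)) (abs_nonneg _) hρ0.le
      · rw [abs_mul, abs_two]
        linarith
      · exact hxy.trans (min_le_left _ _)
    have := (abs_le.1 h3).1
    nlinarith
  have h3 := hsq _ _ (h1.trans hd) (hBw t (hsub ht))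
  have h4 := hsq _ _ (h2.trans hd) (hBw₁ t (hsub ht))
  have h5 : w t₀ ^ 2 + w₁ t₀ ^ 2 ≤ w t ^ 2 + w₁ t ^ 2 := hmin ht
  have h6 : 0 < ρ * (2 * B + 1) := by positivity
  linarith

theorem dense_amplifying (hμ₁ : 0 < μ₁) (hμ : μ₁ < μ₂) (hω_pos : ∀ t ∈ Ioc 0 T₀, 0 < ω t)
    (hω_anti : AntitoneOn ω (Ioc 0 T₀)) (hω_lim : Tendsto ω (𝓝[>] 0) atTop) {ev : ℕ → ℝ}
    (hev : ¬ BddAbove (range ev)) (K : ℕ) : Dense (amplifying hT μ₁ μ₂ ω ev K) := by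
  refine Metric.dense_iff.2 fun c₀ ε hε => ?_
  obtain ⟨c₁, hc₁, τ, hτ, γ, hγ, hc₁γ⟩ :=
    exists_dist_lt_const_near_zero hμ hω_pos hω_anti c₀ (half_pos hε)
  obtain ⟨l₀, hl₀⟩ := exists_dist_lt_amplified hμ₁ hω_pos hω_anti hω_lim c₁ hτ hγ hc₁γ
    (half_pos hε) (T₁ := T₀ / (K + 1)) (by positivity) (4 * K)
  obtain ⟨_, ⟨n, rfl⟩, hn⟩ := not_bddAbove_iff.1 hev (max l₀ (K + 2))
  obtain ⟨c, hc, w, w₁, hw, hlt⟩ := hl₀ (ev n) ((le_max_left _ _).trans hn.le)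
  refine ⟨c, ?_, n, (le_max_right _ _).trans_lt hn, w, w₁, hw, hlt⟩
  rw [Metric.mem_ball]
  linarith [dist_triangle c c₁ c₀]

end PS1

/-! ### Eigenvectors, spectral measures and powers of the operator -/

section Operator

variable {𝕜 : Type*} [RCLike 𝕜] {H : Type*} [NormedAddCommGroup H] [InnerProductSpace 𝕜 H]

/-- `e` is an eigenvector of `A` with eigenvalue `l`. -/
def IsEigenvector (A : H →ₗ.[𝕜] H) (l : ℝ) (e : H) : Prop :=
  ∃ h : e ∈ A.domain, A ⟨e, h⟩ = (l : 𝕜) • e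

namespace IsEigenvector

variable {A : H →ₗ.[𝕜] H} {l : ℝ} {e : H}

theorem inner_apply [CompleteSpace H] (hA : IsSelfAdjoint A) (he : IsEigenvector A l e)
    (y : A.domain) : ⟪e, A y⟫_𝕜 = (l : 𝕜) * ⟪e, (y : H)⟫_𝕜 := by
  obtain ⟨h, hAe⟩ := he
  have hf := LinearPMap.adjoint_isFormalAdjoint hA.dense_domain
  rw [LinearPMap.isSelfAdjoint_def.1 hA] at hf
  have := hf ⟨e, h⟩ y
  rw [hAe, inner_smul_left, RCLike.conj_ofReal] at this
  exact this.symm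

/-- Moving Aⁿ onto the eigenvector gives lⁿ |⟪e, φ⟫| ≤ ‖e‖ C rⁿ, and (r/l)ⁿ → 0. -/
theorem inner_eq_zero_of_mem_band [CompleteSpace H] (hA : IsSelfAdjoint A)
    (he : IsEigenvector A l e) {r : ℝ≥0} (hr : (r : ℝ) < l) {φ : H} (hφ : φ ∈ band A r) :
    ⟪e, φ⟫_𝕜 = 0 := by
  obtain ⟨C, ψ, rfl, hg, hb⟩ := hφ
  have hl : 0 < l := r.2.trans_lt hr
  have hstep : ∀ n, ⟪e, ψ n⟫_𝕜 = (l : 𝕜) ^ n * ⟪e, ψ 0⟫_𝕜 := by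
    intro n
    induction n with
    | zero => simp
    | succ n ih =>
      have hd := LinearPMap.mem_domain_of_mem_graph (hg n)
      have h1 : A ⟨ψ n, hd⟩ = ψ (n + 1) := ((LinearPMap.image_iff hd).2 (hg n)).symm
      rw [← h1, he.inner_apply hA, ih, pow_succ']
      ring
  have hbound : ∀ n, ‖⟪e, ψ 0⟫_𝕜‖ ≤ ‖e‖ * C * ((r : ℝ) / l) ^ n := by
    intro n
    have h1 : l ^ n * ‖⟪e, ψ 0⟫_𝕜‖ ≤ ‖e‖ * (C * (r : ℝ) ^ n) := by
      have h2 := norm_inner_le_norm (𝕜 := 𝕜) e (ψ n)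
      rw [hstep, norm_mul, norm_pow, RCLike.norm_ofReal, abs_of_pos hl] at h2
      exact h2.trans (mul_le_mul_of_nonneg_left (hb n) (norm_nonneg _))
    rw [div_pow, mul_div_assoc', le_div_iff₀ (pow_pos hl n)]
    linarith
  have hlim : Tendsto (fun n : ℕ => ‖e‖ * C * ((r : ℝ) / l) ^ n) atTop (𝓝 0) := by
    simpa using (tendsto_pow_atTop_nhds_zero_of_lt_one (div_nonneg r.2 hl.le)
      ((div_lt_one hl).2 hr)).const_mul (‖e‖ * C)
  exact norm_le_zero_iff.1 (ge_of_tendsto' hlim hbound)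

theorem mem_testSpace (he : IsEigenvector A l e) : e ∈ testSpace A := by
  obtain ⟨h, hAe⟩ := he
  refine ⟨⟨|l|, abs_nonneg l⟩, ‖e‖, fun n => (l : 𝕜) ^ n • e, by simp, fun n => ?_, fun n => ?_⟩
  · have h1 : (e, (l : 𝕜) • e) ∈ A.graph := by
      rw [← hAe]
      exact A.mem_graph ⟨e, h⟩
    have := A.graph.smul_mem ((l : 𝕜) ^ n) h1
    rwa [Prod.smul_mk, smul_smul, ← pow_succ] at this
  · rw [norm_smul, norm_pow, RCLike.norm_ofReal, mul_comm]
    exact le_rfl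

/-- The component along an eigenvector of the solution of the resolvent equation. -/
theorem inner_resolvent [CompleteSpace H] (hA : IsSelfAdjoint A) (he : IsEigenvector A l e)
    (hl : 0 ≤ l) {s : ℝ} (hs : 0 < s) {x : H} {y : A.domain}
    (hy : A y + (s : 𝕜) • (y : H) = x) :
    ⟪e, (y : H)⟫_𝕜 = (((l + s)⁻¹ : ℝ) : 𝕜) * ⟪e, x⟫_𝕜 := by
  rw [← hy, inner_add_right, inner_smul_right, he.inner_apply hA, ← add_mul, ← mul_assoc]
  have : ((l + s : ℝ) : 𝕜) ≠ 0 := RCLike.ofReal_ne_zero.2 (by linarith)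
  rw [← RCLike.ofReal_add, RCLike.ofReal_inv, inv_mul_cancel₀ this, one_mul]

/-- The point mass at l is a spectral measure of a unit eigenvector. An upper bound for the infimum
needs only this one measure, not uniqueness. -/
theorem powNorm_le [CompleteSpace H] (hA : IsSelfAdjoint A) (he : IsEigenvector A l e)
    (hl : 0 ≤ l) (hn : ‖e‖ = 1) {α : ℝ} (hα : 0 ≤ α) :
    powNorm A α e ≤ ENNReal.ofReal (l ^ α) := by
  refine (iInf₂_le (Measure.dirac l.toNNReal) ?_).trans ?_
  · refine ⟨inferInstance, fun s hs y hy => ?_⟩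
    rw [he.inner_resolvent hA hl hs hy, inner_self_eq_norm_sq_to_K, hn, integral_dirac,
      Real.coe_toNNReal l hl]
    simp
  · rw [lintegral_dirac, ← ENNReal.rpow_mul]
    have h1 : 2 * α * (1 / 2) = α := by ring
    rw [h1, ENNReal.ofNNReal_toNNReal, ENNReal.ofReal_rpow_of_nonneg hl hα]

end IsEigenvector

/-- A polynomial bound for the components of the elements of `D(A ^ α)`. -/
theorem exists_norm_apply_le_of_mem_domPow [CompleteSpace H] {A : H →ₗ.[𝕜] H}
    (hA : IsSelfAdjoint A) {α : ℝ} {T : Hyperdistribution A} (hT : T ∈ domPow A α) :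
    ∃ (C : ℝ) (M : ℕ), ∀ (l : ℝ) (e : testSpace A), 1 ≤ l → ‖(e : H)‖ = 1 →
      IsEigenvector A l (e : H) → ‖T e‖ ≤ C * l ^ M := by
  by_cases hα : 0 ≤ α
  · obtain ⟨x, hx, -⟩ : ∃ x : H, (∀ φ : testSpace A, T φ = ⟪x, (φ : H)⟫_𝕜) ∧
        powNorm A α x < ∞ := by simpa only [domPow, mem_ofPred_eq, if_pos hα] using hT
    refine ⟨‖x‖, 0, fun l e _ he _ => ?_⟩
    rw [hx, pow_zero]
    have := norm_inner_le_norm (𝕜 := 𝕜) x (e : H)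
    rwa [he] at this
  · obtain ⟨C, hC⟩ : ∃ C : ℝ≥0, ∀ φ : testSpace A,
        ‖T φ‖ₑ ≤ C * (‖(φ : H)‖ₑ + powNorm A (-α) (φ : H)) := by
      simpa only [domPow, mem_ofPred_eq, if_neg hα] using hT
    -- For negative α the duality bound is tested on `e` itself, whose graph norm is at most 2 l^M
    -- because l ≥ 1.
    obtain ⟨M, hM⟩ := exists_nat_ge (-α)
    refine ⟨C * 2, M, fun l e hl he hAe => ?_⟩
    have hl0 : 0 ≤ l := by linarith
    have h1 : ‖T e‖ₑ ≤ ENNReal.ofReal (C * 2 * l ^ M) := by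
      refine (hC e).trans ?_
      have h2 : ‖(e : H)‖ₑ ≤ ENNReal.ofReal (l ^ M) := by
        rw [← ofReal_norm, he]
        exact ENNReal.ofReal_le_ofReal (one_le_pow₀ hl)
      have h3 : powNorm A (-α) (e : H) ≤ ENNReal.ofReal (l ^ M) := by
        refine (hAe.powNorm_le hA hl0 he (by linarith)).trans (ENNReal.ofReal_le_ofReal ?_)
        rw [← Real.rpow_natCast]
        exact Real.rpow_le_rpow_of_exponent_le hl hM
      have h4 : 0 ≤ l ^ M := pow_nonneg hl0 M
      calc (C : ℝ≥0∞) * (‖(e : H)‖ₑ + powNorm A (-α) (e : H))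
          ≤ C * (ENNReal.ofReal (l ^ M) + ENNReal.ofReal (l ^ M)) := by gcongr
        _ = ENNReal.ofReal (C * 2 * l ^ M) := by
            rw [← ENNReal.ofReal_add h4 h4, ← ENNReal.ofReal_coe_nnreal,
              ← ENNReal.ofReal_mul C.coe_nonneg]
            congr 1
            ring
    rw [← ofReal_norm] at h1
    exact (ENNReal.ofReal_le_ofReal_iff (by positivity)).1 h1

/-- The spectral measure of a superposition of eigenvectors. -/
theorem isSpectralMeasure_sum [CompleteSpace H] {A : H →ₗ.[𝕜] H} (hA : IsSelfAdjoint A)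
    {e : ℕ → H} (he : Orthonormal 𝕜 e) {l : ℕ → ℝ≥0} (hl : ∀ n, IsEigenvector A (l n) (e n))
    {b : ℕ → ℝ} {x : H} (hx : HasSum (fun n => (b n : 𝕜) • e n) x) :
    IsSpectralMeasure A x
      (Measure.sum fun n => ENNReal.ofReal (b n ^ 2) • Measure.dirac (l n)) := by
  have hbx : ∀ n, ⟪e n, x⟫_𝕜 = b n := by
    intro n
    have h1 := (innerSL 𝕜 (e n)).hasSum hx
    refine h1.unique ?_
    convert hasSum_single n fun m hm => ?_ using 1
    · simp [he.1 n]
    · simp [he.2 hm.symm]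
  have hb : Summable fun n => b n ^ 2 := by
    have := he.inner_products_summable (𝕜 := 𝕜) x
    refine this.congr fun n => ?_
    rw [hbx, RCLike.norm_ofReal, sq_abs]
  have hfin : IsFiniteMeasure
      (Measure.sum fun n => ENNReal.ofReal (b n ^ 2) • Measure.dirac (l n)) := by
    refine ⟨?_⟩
    rw [Measure.sum_apply _ MeasurableSet.univ]
    simp only [Measure.smul_apply, measure_univ, smul_eq_mul, mul_one]
    rw [← ENNReal.ofReal_tsum_of_nonneg (fun n => sq_nonneg _) hb]
    exact ENNReal.ofReal_lt_top
  refine ⟨hfin, fun s hs y hy => ?_⟩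
  have hint : Integrable (fun ξ : ℝ≥0 => ((ξ : ℝ) + s)⁻¹)
      (Measure.sum fun n => ENNReal.ofReal (b n ^ 2) • Measure.dirac (l n)) := by
    refine Integrable.of_bound (by fun_prop) s⁻¹ (Eventually.of_forall fun ξ => ?_)
    have hξ : (0 : ℝ) ≤ ξ := ξ.2
    rw [Real.norm_eq_abs, abs_of_nonneg (by positivity)]
    exact inv_anti₀ hs (by linarith)
  have h1 := hasSum_integral_measure hint
  have h2 : HasSum (fun n => ((b n ^ 2 * ((l n : ℝ) + s)⁻¹ : ℝ) : 𝕜)) ⟪x, (y : H)⟫_𝕜 := by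
    have h3 := (innerSLFlip 𝕜 (y : H)).hasSum hx
    refine h3.congr_fun fun n => ?_
    rw [innerSLFlip_apply_apply, inner_smul_left, RCLike.conj_ofReal,
      (hl n).inner_resolvent hA (l n).coe_nonneg hs hy, hbx]
    push_cast
    ring
  refine h2.unique ?_
  rw [RCLike.hasSum_ofReal]
  refine h1.congr_fun fun n => ?_
  rw [integral_smul_measure, integral_dirac, ENNReal.toReal_ofReal (sq_nonneg _), smul_eq_mul]

/-- The discrete spectral measure of x is a competitor in the infimum, and its moment of order 2α is
the given series. -/
theorem powNorm_le_of_hasSum [CompleteSpace H] {A : H →ₗ.[𝕜] H} (hA : IsSelfAdjoint A)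
    {e : ℕ → H} (he : Orthonormal 𝕜 e) {l : ℕ → ℝ≥0} (hl : ∀ n, IsEigenvector A (l n) (e n))
    {b : ℕ → ℝ} {x : H} (hx : HasSum (fun n => (b n : 𝕜) • e n) x) {α : ℝ} (hα : 0 ≤ α)
    (hb : Summable fun n => b n ^ 2 * (l n : ℝ) ^ (2 * α)) : powNorm A α x < ∞ := by
  refine (iInf₂_le _ (isSpectralMeasure_sum hA he hl hx)).trans_lt ?_
  refine ENNReal.rpow_lt_top_of_nonneg (by norm_num) (ne_of_lt ?_)
  rw [lintegral_sum_measure]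
  have h1 : ∀ n, ∫⁻ ξ : ℝ≥0, (ξ : ℝ≥0∞) ^ (2 * α) ∂(ENNReal.ofReal (b n ^ 2) •
      Measure.dirac (l n)) = ENNReal.ofReal (b n ^ 2 * (l n : ℝ) ^ (2 * α)) := by
    intro n
    rw [lintegral_smul_measure, lintegral_dirac, smul_eq_mul, ENNReal.ofReal_mul (sq_nonneg _),
      ← ENNReal.ofReal_rpow_of_nonneg (l n).coe_nonneg (by linarith), ENNReal.ofReal_coe_nnreal]
  simp only [h1]
  rw [← ENNReal.ofReal_tsum_of_nonneg
    (fun n => mul_nonneg (sq_nonneg _) (Real.rpow_nonneg (l n).coe_nonneg _)) hb]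
  exact ENNReal.ofReal_lt_top

end Operator

/-! ### Superpositions of modes and infinite derivative loss -/

section Series

variable {𝕜 : Type*} [RCLike 𝕜] {H : Type*} [NormedAddCommGroup H] [InnerProductSpace 𝕜 H]

/-- A sequence of vectors such that only finitely many are not orthogonal to each spectral
subspace. -/
def IsBandFinite (A : H →ₗ.[𝕜] H) (e : ℕ → H) : Prop :=
  ∀ r : ℝ≥0, ∃ N, ∀ φ ∈ band A r, ∀ n, N ≤ n → ⟪e n, φ⟫_𝕜 = 0

variable {A : H →ₗ.[𝕜] H} {e : ℕ → H}

theorem IsBandFinite.exists_forall (he : IsBandFinite A e) (φ : testSpace A) :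
    ∃ N, ∀ n, N ≤ n → ⟪e n, (φ : H)⟫_𝕜 = 0 := by
  obtain ⟨r, hr⟩ := φ.2
  obtain ⟨N, hN⟩ := he r
  exact ⟨N, hN φ hr⟩

/-- Pairing with a test vector truncates the series at an index that does not depend on the
coefficients. Coefficients of any growth are therefore allowed, and differentiation in time is
termwise on a finite sum. -/
theorem tsum_smul_inner_eq_sum {φ : H} {N : ℕ} (hN : ∀ n, N ≤ n → ⟪e n, φ⟫_𝕜 = 0) (b : ℕ → ℝ) :
    ∑' n, b n • ⟪e n, φ⟫_𝕜 = ∑ n ∈ Finset.range N, b n • ⟪e n, φ⟫_𝕜 :=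
  tsum_eq_sum fun n hn => by rw [hN n (by simpa using hn), smul_zero]

/-- The hyperdistribution `∑ b n e n`. -/
noncomputable def Hyperdistribution.ofCoeff (he : IsBandFinite A e) (b : ℕ → ℝ) :
    Hyperdistribution A where
  toLinearMap :=
    { toFun := fun φ => ∑' n, b n • ⟪e n, (φ : H)⟫_𝕜
      map_add' := fun φ ψ => by
        obtain ⟨N, hN⟩ := he.exists_forall φ
        obtain ⟨M, hM⟩ := he.exists_forall ψ
        have h1 : ∀ n, max N M ≤ n → ⟪e n, (φ : H)⟫_𝕜 = 0 := fun n hn =>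
          hN n ((le_max_left _ _).trans hn)
        have h2 : ∀ n, max N M ≤ n → ⟪e n, (ψ : H)⟫_𝕜 = 0 := fun n hn =>
          hM n ((le_max_right _ _).trans hn)
        have h3 : ∀ n, max N M ≤ n → ⟪e n, ((φ + ψ : testSpace A) : H)⟫_𝕜 = 0 := fun n hn => by
          rw [Submodule.coe_add, inner_add_right, h1 n hn, h2 n hn, add_zero]
        rw [tsum_smul_inner_eq_sum h1, tsum_smul_inner_eq_sum h2, tsum_smul_inner_eq_sum h3,
          ← Finset.sum_add_distrib]
        simp only [Submodule.coe_add, inner_add_right, smul_add]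
      map_smul' := fun k φ => by
        obtain ⟨N, hN⟩ := he.exists_forall φ
        have h1 : ∀ n, N ≤ n → ⟪e n, ((k • φ : testSpace A) : H)⟫_𝕜 = 0 := fun n hn => by
          rw [Submodule.coe_smul, inner_smul_right, hN n hn, mul_zero]
        rw [tsum_smul_inner_eq_sum hN, tsum_smul_inner_eq_sum h1, RingHom.id_apply,
          Finset.smul_sum]
        simp only [Submodule.coe_smul, inner_smul_right, smul_eq_mul, mul_smul_comm] }
  bound := fun r => by
    obtain ⟨N, hN⟩ := he r
    refine ⟨∑ n ∈ Finset.range N, |b n| * ‖e n‖, fun φ hφ => ?_⟩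
    change ‖∑' n, b n • ⟪e n, (φ : H)⟫_𝕜‖ ≤ _
    rw [tsum_smul_inner_eq_sum (hN φ hφ), Finset.sum_mul]
    refine (norm_sum_le _ _).trans (Finset.sum_le_sum fun n _ => ?_)
    rw [norm_smul, Real.norm_eq_abs, mul_assoc]
    exact mul_le_mul_of_nonneg_left (norm_inner_le_norm _ _) (abs_nonneg _)

theorem Hyperdistribution.ofCoeff_apply (he : IsBandFinite A e) (b : ℕ → ℝ) (φ : testSpace A) :
    ofCoeff he b φ = ∑' n, b n • ⟪e n, (φ : H)⟫_𝕜 := rfl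

theorem Hyperdistribution.ofCoeff_apply_self (he : IsBandFinite A e) (ho : Orthonormal 𝕜 e)
    (b : ℕ → ℝ) (n : ℕ) (h : e n ∈ testSpace A) : ofCoeff he b ⟨e n, h⟩ = (b n : 𝕜) := by
  rw [ofCoeff_apply, tsum_eq_single n fun m hm => by rw [ho.2 hm, smul_zero],
    inner_self_eq_norm_sq_to_K, ho.1 n]
  simp [RCLike.real_smul_eq_coe_mul]

theorem hasDerivWithinAt_ofCoeff (he : IsBandFinite A e) {b : ℝ → ℕ → ℝ} {b' : ℕ → ℝ}
    {s : Set ℝ} {t : ℝ} (hb : ∀ n, HasDerivWithinAt (fun τ => b τ n) (b' n) s t)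
    (φ : testSpace A) :
    HasDerivWithinAt (fun τ => Hyperdistribution.ofCoeff he (b τ) φ)
      (Hyperdistribution.ofCoeff he b' φ) s t := by
  obtain ⟨N, hN⟩ := he.exists_forall φ
  simp only [Hyperdistribution.ofCoeff_apply, tsum_smul_inner_eq_sum hN]
  exact HasDerivWithinAt.fun_sum fun n _ => (hb n).smul_const _

/-- A superposition of solutions of the single modes is a solution of the equation. -/
theorem isSolution_ofCoeff [CompleteSpace H] (hA : IsSelfAdjoint A) (he : IsBandFinite A e)
    {l : ℕ → ℝ} (hl : ∀ n, IsEigenvector A (l n) (e n)) {T₀ : ℝ} {c : ℝ → ℝ} {w w₁ : ℕ → ℝ → ℝ}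
    (hw : ∀ n, IsModeSolution T₀ (fun t => c t * l n) (w n) (w₁ n)) (a : ℕ → ℝ) :
    IsSolution A T₀ c (fun t => Hyperdistribution.ofCoeff he fun n => a n * w n t)
      (fun t => Hyperdistribution.ofCoeff he fun n => a n * w₁ n t) := by
  intro φ t ht
  refine ⟨hasDerivWithinAt_ofCoeff he (fun n => ((hw n).deriv_fst t ht).const_mul (a n)) φ, ?_⟩
  refine (hasDerivWithinAt_ofCoeff he
    (fun n => ((hw n).deriv_snd t ht).const_mul (a n)) φ).congr_deriv ?_
  rw [Hyperdistribution.ofCoeff_apply, Hyperdistribution.ofCoeff_apply, ← tsum_mul_left,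
    ← tsum_neg]
  refine tsum_congr fun n => ?_
  have : ⟪e n, (testOp A φ : H)⟫_𝕜 = (l n : 𝕜) * ⟪e n, (φ : H)⟫_𝕜 :=
    (hl n).inner_apply hA ⟨φ, testSpace_le_domain A φ.2⟩
  rw [this]
  simp only [RCLike.real_smul_eq_coe_mul]
  push_cast
  ring

/-- Sufficient condition for a superposition of eigenvectors to belong to `D(A ^ α)`. -/
theorem ofCoeff_mem_domPow [CompleteSpace H] (hA : IsSelfAdjoint A) (he : IsBandFinite A e)
    (ho : Orthonormal 𝕜 e) {l : ℕ → ℝ} (hl0 : ∀ n, 0 ≤ l n)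
    (hl : ∀ n, IsEigenvector A (l n) (e n)) {b : ℕ → ℝ} (hb : Summable fun n => |b n|) {α : ℝ}
    (hα : 0 ≤ α) (hbα : Summable fun n => b n ^ 2 * l n ^ (2 * α)) :
    Hyperdistribution.ofCoeff he b ∈ domPow A α := by
  have hs : Summable fun n => (b n : 𝕜) • e n := by
    refine Summable.of_norm (hb.congr fun n => ?_)
    rw [norm_smul, ho.1 n, mul_one, RCLike.norm_ofReal]
  obtain ⟨x, hx⟩ := hs
  have hcoe : ∀ n, ((l n).toNNReal : ℝ) = l n := fun n => Real.coe_toNNReal _ (hl0 n)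
  have hpow : powNorm A α x < ∞ :=
    powNorm_le_of_hasSum hA ho (l := fun n => (l n).toNNReal)
      (fun n => by rw [hcoe]; exact hl n) hx hα (by simpa only [hcoe] using hbα)
  simp only [domPow, mem_ofPred_eq, if_pos hα]
  refine ⟨x, fun φ => ?_, hpow⟩
  have h := (innerSLFlip 𝕜 (φ : H)).hasSum hx
  rw [innerSLFlip_apply_apply] at h
  rw [Hyperdistribution.ofCoeff_apply, ← h.tsum_eq]
  refine tsum_congr fun n => ?_
  rw [innerSLFlip_apply_apply, inner_smul_left, RCLike.conj_ofReal, RCLike.real_smul_eq_coe_mul]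

/-- A sequence of modes that are amplified more than polynomially produces an infinite derivative
loss. -/
theorem hasInfiniteDerivativeLoss_of_amplified [CompleteSpace H] (hA : IsSelfAdjoint A)
    (ho : Orthonormal 𝕜 e) {l : ℕ → ℝ} (hl : ∀ n, IsEigenvector A (l n) (e n)) {κ : ℕ → ℕ}
    (hκ : ∀ n, n ≤ κ n) (hlκ : ∀ n, (κ n + 2 : ℝ) < l n) {T₀ : ℝ} {c : ℝ → ℝ} {w w₁ : ℕ → ℝ → ℝ}
    (hw : ∀ n, IsModeSolution T₀ (fun t => c t * l n) (w n) (w₁ n))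
    (hamp : ∀ n, ∀ t ∈ Icc (T₀ / (κ n + 1)) T₀, l n ^ (4 * κ n) < w n t ^ 2 + w₁ n t ^ 2) :
    HasInfiniteDerivativeLoss A T₀ c := by
  have hκ' : ∀ n : ℕ, (n : ℝ) ≤ κ n := fun n => by exact_mod_cast hκ n
  have hl2 : ∀ n, 2 ≤ l n := fun n => by
    have : (0 : ℝ) ≤ κ n := Nat.cast_nonneg _
    linarith [hlκ n]
  have hl0 : ∀ n, 0 < l n := fun n => by linarith [hl2 n]
  have he : IsBandFinite A e := by
    intro r
    obtain ⟨N, hN⟩ := exists_nat_ge (r : ℝ)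
    refine ⟨N, fun φ hφ n hn => (hl n).inner_eq_zero_of_mem_band hA ?_ hφ⟩
    have : (N : ℝ) ≤ n := by exact_mod_cast hn
    linarith [hκ' n, hlκ n]
  -- The exponent tends to infinity, so `a` beats every fixed power of `l`; still a² l^(4κ) =
  -- l^(2κ), so the amplification wins at positive times.
  set a : ℕ → ℝ := fun n => (l n ^ κ n)⁻¹ with ha
  have ha0 : ∀ n, 0 < a n := fun n => inv_pos.2 (pow_pos (hl0 n) _)
  have hgeom : ∀ n, (l n ^ n)⁻¹ ≤ (1 / 2 : ℝ) ^ n := fun n => by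
    rw [one_div, inv_pow]
    exact inv_anti₀ (by positivity) (pow_le_pow_left₀ zero_le_two (hl2 n) n)
  have hsum : Summable fun n : ℕ => (1 / 2 : ℝ) ^ n := summable_geometric_two
  have hasum : Summable fun n => |a n| := by
    refine Summable.of_nonneg_of_le (fun n => abs_nonneg _) (fun n => ?_) hsum
    rw [abs_of_pos (ha0 n)]
    refine le_trans ?_ (hgeom n)
    exact inv_anti₀ (pow_pos (hl0 n) _) (pow_le_pow_right₀ (by linarith [hl2 n]) (hκ n))
  refine ⟨fun t => Hyperdistribution.ofCoeff he fun n => a n * w n t,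
    fun t => Hyperdistribution.ofCoeff he fun n => a n * w₁ n t,
    isSolution_ofCoeff hA he hl hw a, fun β hβ => ⟨?_, ?_⟩, fun β hβ t ht => ?_⟩
  · simp only [(hw _).init_fst, mul_zero]
    exact ofCoeff_mem_domPow hA he ho (fun n => (hl0 n).le) hl (by simp) (by linarith) (by simp)
  · simp only [(hw _).init_snd, mul_one]
    refine ofCoeff_mem_domPow hA he ho (fun n => (hl0 n).le) hl hasum hβ.le ?_
    -- From the index `M` on, κ ≥ 2β, so one of the two factors `a` absorbs l^(2β) and the other is
    -- dominated by a geometric series.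
    obtain ⟨M, hM⟩ := exists_nat_ge (2 * β)
    refine (summable_nat_add_iff M).1 ?_
    refine Summable.of_nonneg_of_le (fun n => ?_) (fun n => ?_) ((summable_nat_add_iff M).2 hsum)
    · exact mul_nonneg (sq_nonneg _) (Real.rpow_nonneg (hl0 _).le _)
    · refine le_trans ?_ (hgeom (n + M))
      set k := n + M with hk
      have h1 : 1 ≤ l k := by linarith [hl2 k]
      have h2 : l k ^ (2 * β) ≤ l k ^ M := by
        rw [← Real.rpow_natCast]
        exact Real.rpow_le_rpow_of_exponent_le h1 hM
      have h3 : l k ^ M ≤ l k ^ κ k := pow_le_pow_right₀ h1 (le_trans (by omega) (hκ k))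
      have h4 : a k ≤ (l k ^ k)⁻¹ :=
        inv_anti₀ (pow_pos (hl0 k) _) (pow_le_pow_right₀ h1 (hκ k))
      have h5 : a k * l k ^ κ k = 1 := inv_mul_cancel₀ (pow_pos (hl0 k) _).ne'
      calc a k ^ 2 * l k ^ (2 * β) ≤ a k ^ 2 * l k ^ κ k :=
            mul_le_mul_of_nonneg_left (h2.trans h3) (sq_nonneg _)
        _ = a k * (a k * l k ^ κ k) := by ring
        _ = a k := by rw [h5, mul_one]
        _ ≤ _ := h4
  · rintro ⟨hu, hv⟩
    obtain ⟨C₁, M₁, h₁⟩ := exists_norm_apply_le_of_mem_domPow hA hu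
    obtain ⟨C₂, M₂, h₂⟩ := exists_norm_apply_le_of_mem_domPow hA hv
    set M := max M₁ M₂ with hM
    set C := max (max C₁ C₂) 0 with hC
    have hC0 : 0 ≤ C := le_max_right _ _
    -- The three requirements put t in the amplification interval, make 2C² smaller than l, and give
    -- 2M + 1 ≤ 2κ. The polynomial bound 2C² l^(2M) is then at most l^(2κ).
    obtain ⟨n, hn⟩ := exists_nat_ge (max (T₀ / t) (max (2 * C ^ 2) (M + 1)))
    have hnκ := hn.trans (hκ' n)
    have hnt : T₀ / (κ n + 1) ≤ t := by
      have h := (le_max_left _ _).trans hnκ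
      rw [div_le_iff₀ ht.1] at h
      rw [div_le_iff₀ (by positivity)]
      linarith [ht.1]
    have hnC : 2 * C ^ 2 ≤ κ n := ((le_max_left _ _).trans (le_max_right _ _)).trans hnκ
    have hnM : M + 1 ≤ κ n := by
      exact_mod_cast ((le_max_right _ _).trans (le_max_right _ _)).trans hnκ
    have h1 : 1 ≤ l n := by linarith [hl2 n]
    have hp : 0 < l n ^ M := pow_pos (hl0 n) M
    have hb₁ := h₁ (l n) ⟨e n, (hl n).mem_testSpace⟩ h1 (ho.1 n) (hl n)
    have hb₂ := h₂ (l n) ⟨e n, (hl n).mem_testSpace⟩ h1 (ho.1 n) (hl n)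
    rw [Hyperdistribution.ofCoeff_apply_self he ho, RCLike.norm_ofReal] at hb₁ hb₂
    have hle : ∀ (C' : ℝ) (M' : ℕ), C' ≤ C → M' ≤ M → C' * l n ^ M' ≤ C * l n ^ M := by
      intro C' M' hC' hM'
      exact (mul_le_mul_of_nonneg_right hC' (pow_nonneg (hl0 n).le _)).trans
        (mul_le_mul_of_nonneg_left (pow_le_pow_right₀ h1 hM') hC0)
    have hb₁ := hb₁.trans (hle C₁ M₁ ((le_max_left _ _).trans (le_max_left _ _)) (le_max_left _ _))
    have hb₂ := hb₂.trans (hle C₂ M₂ ((le_max_right _ _).trans (le_max_left _ _))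
      (le_max_right _ _))
    have hs₁ := sq_le_sq' (abs_le.1 hb₁).1 (abs_le.1 hb₁).2
    have hs₂ := sq_le_sq' (abs_le.1 hb₂).1 (abs_le.1 hb₂).2
    have hlow : l n ^ (2 * κ n) < 2 * C ^ 2 * (l n ^ M) ^ 2 := by
      have h3 := mul_lt_mul_of_pos_left (hamp n t ⟨hnt, ht.2⟩) (pow_pos (ha0 n) 2)
      have h4 : a n ^ 2 * l n ^ (4 * κ n) = l n ^ (2 * κ n) := by
        have h5 : a n * l n ^ κ n = 1 := inv_mul_cancel₀ (pow_pos (hl0 n) _).ne'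
        calc a n ^ 2 * l n ^ (4 * κ n) = (a n * l n ^ κ n) ^ 2 * l n ^ (2 * κ n) := by ring
          _ = l n ^ (2 * κ n) := by rw [h5, one_pow, one_mul]
      rw [h4] at h3
      refine h3.trans_le ?_
      calc a n ^ 2 * (w n t ^ 2 + w₁ n t ^ 2) = (a n * w n t) ^ 2 + (a n * w₁ n t) ^ 2 := by ring
        _ ≤ _ := by linarith
    have hhigh : 2 * C ^ 2 * (l n ^ M) ^ 2 ≤ l n ^ (2 * κ n) := by
      have h3 : 2 * C ^ 2 ≤ l n := by linarith [hlκ n]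
      calc 2 * C ^ 2 * (l n ^ M) ^ 2 ≤ l n * (l n ^ M) ^ 2 :=
            mul_le_mul_of_nonneg_right h3 (sq_nonneg _)
        _ = l n ^ (2 * M + 1) := by ring
        _ ≤ l n ^ (2 * κ n) := pow_le_pow_right₀ h1 (by omega)
    exact absurd hlow (not_lt.2 hhigh)

end Series

/-- A propagation speed that amplifies some mode at every order produces an infinite derivative
loss. -/
theorem hasInfiniteDerivativeLoss_of_forall_amplifying {𝕜 : Type*} [RCLike 𝕜] {H : Type*}
    [NormedAddCommGroup H] [InnerProductSpace 𝕜 H] [CompleteSpace H] {A : H →ₗ.[𝕜] H}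
    (hA : IsSelfAdjoint A) {e : ℕ → H} (ho : Orthonormal 𝕜 e) {ev : ℕ → ℝ}
    (hev : ∀ n, IsEigenvector A (ev n) (e n)) {T₀ : ℝ} {hT : 0 < T₀} {μ₁ μ₂ : ℝ} {ω : ℝ → ℝ}
    {c : PS1 hT μ₁ μ₂ ω} (hc : ∀ K, c ∈ PS1.amplifying hT μ₁ μ₂ ω ev K) :
    HasInfiniteDerivativeLoss A T₀ c.toFun := by
  choose ν hν w w₁ hw hamp using hc
  -- The same eigenvector may be selected for several `K`. Passing to a subsequence with strictly
  -- increasing eigenvalues makes the selection injective, hence orthonormal, and a strictly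
  -- increasing κ satisfies n ≤ κ n.
  have hlim : Tendsto (fun K => ev (ν K)) atTop atTop :=
    tendsto_atTop_mono (fun K => by linarith [hν K]) tendsto_natCast_atTop_atTop
  obtain ⟨κ, hκ, hκ'⟩ := strictMono_subseq_of_tendsto_atTop hlim
  have hinj : Function.Injective fun n => ν (κ n) := fun m n h =>
    hκ'.injective (congrArg ev h)
  exact hasInfiniteDerivativeLoss_of_amplified hA (ho.comp _ hinj) (fun n => hev (ν (κ n)))
    (fun n => hκ.le_apply) (fun n => hν (κ n)) (fun n => hw (κ n)) (fun n => hamp (κ n))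

end DerivativeLoss

theorem theorem2p9 {𝕜 : Type*} [RCLike 𝕜] {H : Type*} [NormedAddCommGroup H]
    [InnerProductSpace 𝕜 H] [CompleteSpace H] (A : H →ₗ.[𝕜] H)
    (hA : DerivativeLoss.IsNonnegSelfAdjoint A)
    (hA' : DerivativeLoss.IsUnboundedPosMulOperator A)
    (T₀ μ₁ μ₂ : ℝ) (hT : 0 < T₀) (hμ₁ : 0 < μ₁) (hμ : μ₁ < μ₂)
    (ω : ℝ → ℝ) (hω_pos : ∀ t ∈ Ioc 0 T₀, 0 < ω t) (hω_anti : AntitoneOn ω (Ioc 0 T₀))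
    (hω_lim : Tendsto ω (𝓝[>] 0) atTop) :
    CompleteSpace (DerivativeLoss.PS1 hT μ₁ μ₂ ω) ∧
    {c : DerivativeLoss.PS1 hT μ₁ μ₂ ω |
      DerivativeLoss.HasInfiniteDerivativeLoss A T₀ c.toFun} ∈
        residual (DerivativeLoss.PS1 hT μ₁ μ₂ ω) := by
  refine ⟨DerivativeLoss.PS1.completeSpace hω_pos hω_anti, ?_⟩
  obtain ⟨e, ev, ho, -, hev, hAe⟩ := hA'
  have hres : ⋂ K, DerivativeLoss.PS1.amplifying hT μ₁ μ₂ ω ev K ∈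
      residual (DerivativeLoss.PS1 hT μ₁ μ₂ ω) :=
    countable_iInter_mem.2 fun K => residual_of_dense_open
      (DerivativeLoss.PS1.isOpen_amplifying hμ₁ ev K)
      (DerivativeLoss.PS1.dense_amplifying hμ₁ hμ hω_pos hω_anti hω_lim hev K)
  filter_upwards [hres] with c hc
  exact DerivativeLoss.hasInfiniteDerivativeLoss_of_forall_amplifying hA.1 ho hAe
    (mem_iInter.1 hc)
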